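/- For $n\ge 0$ let $a_n=\binom{2n}{n}/4^n$ (so $a_0=1$). For $w\ge 0$ let $\mathrm{CMZV}^4_w\subset\mathbb C$ be the $\mathbb Q$-linear span of the level-4 colored multiple zeta values of weight $w$, i.e. of the numbers $$\mathrm{Li}_{k_1,\dots,k_r}(z_1,\dots,z_r)=\lim_{N\to\infty}\ \sum_{N\ge n_1>\cdots>n_r>0}\frac{z_1^{n_1}\cdots z_r^{n_r}}{n_1^{k_1}\cdots n_r^{k_r}}$$ with $r\ge 0$, integers $k_j\ge 1$, $k_1+\cdots+k_r=w$, $z_j^4=1$ and $(k_1,z_1)\neq(1,1)$ (for $r=0$ the value is $1$, of weight $0$). Let $\mathrm{CMZV}^4_{\le w}=\sum_{k\le w}\mathrm{CMZV}^4_k$, and let $\mathrm{CMZV}^4_{\le w}\otimes\mathbb Q[i]$ denote its $\mathbb Q[i]$-span in $\mathbb C$. Let $d\ge 1$, let $\mathbf s=(s_1,\dots,s_d)$ be positive integers, $|\mathbf s|=s_1+\cdots+s_d$, and let each $l_j(n)$ be one of $2n$, $2n+1$, $2n-1$. Put $\delta(l)=0$ if $l(n)=2n$ and $\delta(l)=1$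 if $l(n)=2n\pm1$. Put $\nu=1$ if $l_1(n)=2n-1$ and $s_1\ge 2$, and $\nu=0$ otherwise. Set $$\Xi(\mathbf l;\mathbf s)=\sum_{n_1\,\underset{1}{\succ}\,\cdots\,\underset{d-1}{\succ}\,n_d\,\underset{d}{\succ}\,0}\frac{a_{n_1}}{l_1(n_1)^{s_1}\cdots l_d(n_d)^{s_d}},$$ where $\underset{j}{\succ}$ is $\ge$ if $l_j(n)=2n+1$ and $>$ otherwise. (a) If $l_1(n)\ne 2n-1$, and no $l_j(n)=2n$ is immediately followed by $l_{j+1}(n)=2n-1$ (in particular, if all $l_j(n)\in\{2n,2n+1\}$), then the series converges absolutely and $\Xi(\mathbf l;\mathbf s)\in i^{\delta(l_1)}\,\mathrm{CMZV}^4_{|\mathbf s|}$. (b) In general the series converges absolutely and $\Xi(\mathbf l;\mathbf s)\in \mathrm{CMZV}^4_{\le |\mathbf s|-\nu}\otimes\mathbb Q[i]$. (c) The same holds if each of the $d$ inequality signs $\underset{1}{\succ},\dots,\underset{d}{\succ}$ is replaced by an arbitrary choice of $>$ or $\ge$, provided the series is defined, i.e. no $l_j(n_j)$ vanishes on the range of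 summation. -/

import Mathlib

noncomputable section

/-- The three linear forms `2n`, `2n + 1`, `2n - 1` that occur in the denominators. -/
inductive LinForm where
  | even
  | oddPlus
  | oddMinus
  deriving DecidableEq

/-- The value of a linear form at `n`, as a real number (so `2n - 1` is `-1` at `n = 0`). -/
def LinForm.val : LinForm → ℕ → ℝ
  | .even, n => 2 * (n : ℝ)
  | .oddPlus, n => 2 * (n : ℝ) + 1
  | .oddMinus, n => 2 * (n : ℝ) - 1

/-- `δ(l) = 0` for `l(n) = 2n` and `δ(l) = 1` for `l(n) = 2n ± 1`. -/
def LinForm.delta : LinForm → ℕ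
  | .even => 0
  | .oddPlus => 1
  | .oddMinus => 1

/-- The weight drop: `1` if the leading factor is `(2n - 1)^s` with `s ≥ 2`, and `0` otherwise. -/
def weightDrop (l : LinForm) (s : ℕ) : ℕ :=
  if l = LinForm.oddMinus ∧ 2 ≤ s then 1 else 0

/-- The index following `n j` in `(n 0, …, n (d - 1), 0)`. -/
def nextIndex {d : ℕ} (n : Fin d → ℕ) (j : Fin d) : ℕ :=
  if h : (j : ℕ) + 1 < d then n ⟨j + 1, h⟩ else 0

/-- The summation range `n 0 ≻ n 1 ≻ ⋯ ≻ n (d - 1) ≻ 0`, where the sign after `n j` is `>` if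
`strict j` is true and `≥` if it is false. -/
def indexRange {d : ℕ} (strict : Fin d → Bool) : Set (Fin d → ℕ) :=
  {n | ∀ j, if strict j then nextIndex n j < n j else nextIndex n j ≤ n j}

/-- The basic choice of signs: `≥` after `n j` if `l j` is `2n + 1`, and `>` otherwise. -/
def basicStrict {d : ℕ} (l : Fin d → LinForm) : Fin d → Bool :=
  fun j => decide (l j ≠ LinForm.oddPlus)

/-- The series is defined: no denominator vanishes on the summation range. -/
def SeriesDefined {d : ℕ} (l : Fin d → LinForm) (strict : Fin d → Bool) : Prop :=
  ∀ n ∈ indexRange strict, ∀ j, (l j).val (n j) ≠ 0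

/-- `a_n = binom(2n, n) / 4^n`. -/
def aperyCoeff (n : ℕ) : ℝ := (Nat.centralBinom n : ℝ) / 4 ^ n

/-- The term `a_{n_1} / (l_1(n_1)^{s_1} ⋯ l_d(n_d)^{s_d})`; the indices run from `0` to `d - 1`. -/
def aperyTerm {d : ℕ} [NeZero d] (l : Fin d → LinForm) (s : Fin d → ℕ) (n : Fin d → ℕ) : ℝ :=
  aperyCoeff (n 0) / ∏ j, (l j).val (n j) ^ s j

/-- The (absolute) convergence of the series with the given choice of signs. -/
def AperySummable {d : ℕ} [NeZero d] (l : Fin d → LinForm) (s : Fin d → ℕ)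
    (strict : Fin d → Bool) : Prop :=
  Summable fun n : indexRange strict => aperyTerm l s n

/-- The sum of the series with the given choice of signs. -/
def aperySum {d : ℕ} [NeZero d] (l : Fin d → LinForm) (s : Fin d → ℕ)
    (strict : Fin d → Bool) : ℝ :=
  ∑' n : indexRange strict, aperyTerm l s n

/-- The partial sum, over `N ≥ n_1 > ⋯ > n_d > 0`, of the multiple polylogarithm series. -/
def polylogPartial {d : ℕ} (s : Fin d → ℕ) (z : Fin d → ℂ) (N : ℕ) : ℂ := by
  classical
  exact ∑ n ∈ (Fintype.piFinset fun _ : Fin d => Finset.Icc 1 N).filter StrictAnti,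
    ∏ j, z j ^ n j / (n j : ℂ) ^ s j

/-- `x` is a colored multiple zeta value of level `4` and weight `w`: the limit of the partial sums
of `Li_s(z)` with positive `s j` of sum `w`, fourth roots of unity `z j`, and leading pair
`(s_1, z_1) ≠ (1, 1)`. The series converges only conditionally if `s_1 = 1`. The empty value
(`d = 0`) is `1`, of weight `0`. -/
def IsCMZV (w : ℕ) (x : ℂ) : Prop :=
  ∃ (d : ℕ) (s : Fin d → ℕ) (z : Fin d → ℂ),
    (∀ j, 1 ≤ s j) ∧ (∀ j, z j ^ 4 = 1) ∧ (∀ j : Fin d, (j : ℕ) = 0 → (s j, z j) ≠ (1, 1)) ∧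
    ∑ j, s j = w ∧ Filter.Tendsto (polylogPartial s z) Filter.atTop (nhds x)

/-- The rational span of the colored multiple zeta values of level `4` and weight `w`. -/
def CMZV (w : ℕ) : Submodule ℚ ℂ := Submodule.span ℚ {x | IsCMZV w x}

/-- The rational span of the colored multiple zeta values of level `4` and weight at most `w`. -/
def CMZVle (w : ℕ) : Submodule ℚ ℂ := Submodule.span ℚ {x | ∃ k ≤ w, IsCMZV k x}

/-- `CMZV_{≤ w} ⊗ ℚ[i]`, as a subspace of `ℂ`: the `ℚ[i]`-span of `CMZV_{≤ w}`. -/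
def CMZVleGauss (w : ℕ) : Submodule (Algebra.adjoin ℚ {Complex.I}) ℂ :=
  Submodule.span (Algebra.adjoin ℚ {Complex.I}) (CMZVle w : Set ℂ)

end

/-!
With `a_n = binom(2n, n) / 4^n`, the nested sums over all indices but the first turn the series into
`∑ a_n V(n)`, where the sequence `V` arises from the indicator of `0` by alternating partial
summations with divisions by `2n`, `2n + 1`, `2n - 1`. Sequences are allowed the junk value `0` of a
division by `0`, so nothing has to be known about the summation range.

The generating series `Ψ_f = ∑ a_n f(n) x^{2n}` satisfies first order differential equations under
these operations, with coefficients in `x` and `√(1 - x²)`. The substitution `x = 2t / (1 + t²)`,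
`√(1 - x²) = (1 - t²) / (1 + t²)` makes them rational: division by `2n` integrates against `dx / x`,
division by `2n + 1` against `dx / √(1 - x²)`, and partial summations contribute further factors
`1 / √(1 - x²)`. For an admissible succession of operations (`PureSeq`) only the forms `dt / t` and
`dt / (σ - t)` with `σ⁴ = 1` occur, and these act on multiple polylogarithms in `t` by `intZero` and
`intPole`. Hence `Ψ_f` (or `x Ψ_f / i`, if the last division was by `2n + 1`) is a rational
combination of multiple polylogarithms of weight `k` at fourth roots of unity (`PureSeq.value`).
The outermost form never has a pole at `t = 1`, so the combination converges there, and Abel's limit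
theorem at `x = t = 1` gives the value of the series (`EvenValue.hasSum`, `OddValue.hasSum`).

A division by `2n - 1` is a division by `2n + 1` conjugated with the shift of the index. For the
basic signs the shift is absorbed by the next summation unless the factor in front is `2n`, which
gives the first claim (`pureChain_wordSum`). In general the signs are corrected by partial
fractions, which do not increase the weight: every `V` is a rational combination of pure sequences
and of shifts of pure sequences (`wordSum_mem`). Summing a shifted sequence against `a_n`
telescopes, by `a_{n - 1} - a_n = a_n / (2n - 1)`, and lowers the weight by one
(`PureSeq.hasSum_succ`); so does every partial fraction of a leading factor `2n - 1`.
-/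

/-! ### Sequences of logarithmic growth -/

/-- `1 + ∑_{m < n} 1 / (m + 1)`, the gauge in which nested sums are estimated. -/
noncomputable def harmonicGauge (n : ℕ) : ℝ := 1 + ∑ m ∈ Finset.range n, 1 / ((m : ℝ) + 1)

/-- The sequence is bounded by a power of the logarithm. -/
def LogBounded {𝕜 : Type*} [NormedField 𝕜] (f : ℕ → 𝕜) : Prop :=
  ∃ (C : ℝ) (r : ℕ), ∀ n, ‖f n‖ ≤ C * harmonicGauge n ^ r

/-- The sequence is bounded by a power of the logarithm divided by `n`. -/
def LogDecaying {𝕜 : Type*} [NormedField 𝕜] (f : ℕ → 𝕜) : Prop :=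
  ∃ (C : ℝ) (r : ℕ), ∀ n, ‖f n‖ ≤ C * harmonicGauge n ^ r / ((n : ℝ) + 1)

/-- `∑_{m < n} f m`. -/
def strictSum {𝕜 : Type*} [AddCommMonoid 𝕜] (f : ℕ → 𝕜) (n : ℕ) : 𝕜 := ∑ m ∈ Finset.range n, f m

/-- `∑_{m ≤ n} f m`. -/
def weakSum {𝕜 : Type*} [AddCommMonoid 𝕜] (f : ℕ → 𝕜) (n : ℕ) : 𝕜 :=
  ∑ m ∈ Finset.range (n + 1), f m

theorem weakSum_eq {𝕜 : Type*} [AddCommMonoid 𝕜] (f : ℕ → 𝕜) :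
    weakSum f = strictSum f + f := by
  ext n; simp [weakSum, strictSum, Finset.sum_range_succ]

theorem one_le_harmonicGauge (n : ℕ) : 1 ≤ harmonicGauge n := by
  unfold harmonicGauge
  have : 0 ≤ ∑ m ∈ Finset.range n, 1 / ((m : ℝ) + 1) := Finset.sum_nonneg fun m _ => by positivity
  linarith

theorem harmonicGauge_mono : Monotone harmonicGauge := by
  refine monotone_nat_of_le_succ fun n => ?_
  unfold harmonicGauge
  rw [Finset.sum_range_succ]
  have : (0 : ℝ) ≤ 1 / ((n : ℝ) + 1) := by positivity
  linarith

theorem harmonicGauge_le (n : ℕ) : harmonicGauge n ≤ (n : ℝ) + 1 := by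
  induction n with
  | zero => simp [harmonicGauge]
  | succ n ih =>
    unfold harmonicGauge at *
    rw [Finset.sum_range_succ]
    have : 1 / ((n : ℝ) + 1) ≤ 1 := by
      rw [div_le_one (by positivity)]; linarith [(Nat.cast_nonneg n : (0 : ℝ) ≤ n)]
    push_cast; linarith

/-- Powers of the gauge grow more slowly than `(n + 1) ^ (1 / 4)`. -/
theorem exists_harmonicGauge_pow_le (r : ℕ) :
    ∃ C : ℝ, 0 ≤ C ∧ ∀ n : ℕ, harmonicGauge n ^ r ≤ C * ((n : ℝ) + 1) ^ (1 / 4 : ℝ) := by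
  -- the estimate `log y ≤ y ^ ε / ε` is raised to the power `r`, and `ε * r ≤ 1 / 4`
  set ε : ℝ := 1 / (4 * ((r : ℝ) + 1)) with hε
  have hε0 : 0 < ε := by positivity
  refine ⟨(2 + 1 / ε) ^ r, by positivity, fun n => ?_⟩
  have hn : (1 : ℝ) ≤ (n : ℝ) + 1 := by linarith [(Nat.cast_nonneg n : (0 : ℝ) ≤ n)]
  have h1 : harmonicGauge n ≤ 2 + Real.log ((n : ℝ) + 1) := by
    have h := harmonic_le_one_add_log n
    have h' : harmonicGauge n = 1 + (harmonic n : ℝ) := by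
      simp [harmonicGauge, harmonic]
    rcases Nat.eq_zero_or_pos n with rfl | hpos
    · simp [harmonicGauge]
    · have : Real.log n ≤ Real.log ((n : ℝ) + 1) :=
        Real.log_le_log (by exact_mod_cast hpos) (by linarith)
      linarith
  have h2 : Real.log ((n : ℝ) + 1) ≤ ((n : ℝ) + 1) ^ ε / ε :=
    Real.log_le_rpow_div (by linarith) hε0
  have h3 : (1 : ℝ) ≤ ((n : ℝ) + 1) ^ ε := Real.one_le_rpow hn hε0.le
  have h4 : harmonicGauge n ≤ (2 + 1 / ε) * ((n : ℝ) + 1) ^ ε := by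
    have : (2 + 1 / ε) * ((n : ℝ) + 1) ^ ε = 2 * ((n : ℝ) + 1) ^ ε + ((n : ℝ) + 1) ^ ε / ε := by
      ring
    linarith
  have h5 := one_le_harmonicGauge n
  calc harmonicGauge n ^ r ≤ ((2 + 1 / ε) * ((n : ℝ) + 1) ^ ε) ^ r :=
        pow_le_pow_left₀ (by linarith) h4 r
    _ = (2 + 1 / ε) ^ r * ((n : ℝ) + 1) ^ (ε * r) := by
        rw [mul_pow, ← Real.rpow_mul_natCast (by linarith)]
    _ ≤ (2 + 1 / ε) ^ r * ((n : ℝ) + 1) ^ (1 / 4 : ℝ) := by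
        refine mul_le_mul_of_nonneg_left (Real.rpow_le_rpow_of_exponent_le hn ?_) (by positivity)
        rw [hε, div_mul_eq_mul_div, div_le_div_iff₀ (by positivity) (by norm_num)]
        linarith

theorem summable_harmonicGauge_div_mul_sqrt (r : ℕ) :
    Summable fun n : ℕ => harmonicGauge n ^ r / ((n : ℝ) + 1) / √((n : ℝ) + 1) := by
  obtain ⟨C, hC, h⟩ := exists_harmonicGauge_pow_le r
  have hs : Summable fun n : ℕ => C * ((n : ℝ) + 1) ^ (-(5 / 4) : ℝ) := by
    refine Summable.mul_left _ ?_
    have := (summable_nat_add_iff 1).2 (Real.summable_nat_rpow.2 (by norm_num : -(5 / 4 : ℝ) < -1))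
    simpa using this
  refine Summable.of_nonneg_of_le (fun n => ?_) (fun n => ?_) hs
  · have := one_le_harmonicGauge n; positivity
  · have hn : (0 : ℝ) < (n : ℝ) + 1 := by positivity
    rw [div_div, div_le_iff₀ (by positivity)]
    refine (h n).trans (le_of_eq ?_)
    rw [Real.sqrt_eq_rpow, mul_assoc]
    congr 1
    nth_rewrite 3 [← Real.rpow_one ((n : ℝ) + 1)]
    rw [← Real.rpow_add hn, ← Real.rpow_add hn]
    norm_num

theorem summable_harmonicGauge_div_sq (r : ℕ) :
    Summable fun n : ℕ => harmonicGauge n ^ r / ((n : ℝ) + 1) / ((n : ℝ) + 1) := by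
  refine Summable.of_nonneg_of_le (fun n => ?_) (fun n => ?_)
    (summable_harmonicGauge_div_mul_sqrt r)
  · have := one_le_harmonicGauge n; positivity
  · have := one_le_harmonicGauge n
    refine div_le_div_of_nonneg_left (by positivity) (by positivity) ?_
    have hn : (0 : ℝ) ≤ n := Nat.cast_nonneg n
    exact Real.sqrt_le_iff.2 ⟨by linarith, by nlinarith⟩

section Growth

variable {𝕜 : Type*} [NormedField 𝕜] {f g : ℕ → 𝕜}

theorem LogBounded.exists_nonneg (hf : LogBounded f) :
    ∃ (C : ℝ) (r : ℕ), 0 ≤ C ∧ ∀ n, ‖f n‖ ≤ C * harmonicGauge n ^ r := by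
  obtain ⟨C, r, h⟩ := hf
  refine ⟨|C|, r, abs_nonneg _, fun n => (h n).trans ?_⟩
  have := one_le_harmonicGauge n
  gcongr
  exact le_abs_self C

theorem logDecaying_iff :
    LogDecaying f ↔ LogBounded fun n => ((n : ℝ) + 1) * ‖f n‖ := by
  have : ∀ n : ℕ, (0 : ℝ) < (n : ℝ) + 1 := fun n => by positivity
  simp only [LogDecaying, LogBounded, le_div_iff₀ (this _), norm_mul, norm_norm,
    Real.norm_of_nonneg (this _).le, mul_comm]

theorem LogBounded.of_le {𝕜' : Type*} [NormedField 𝕜'] {g : ℕ → 𝕜'} (hg : LogBounded g) (C : ℝ)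
    (h : ∀ n, ‖f n‖ ≤ C * ‖g n‖) : LogBounded f := by
  obtain ⟨D, r, hD, hg⟩ := hg.exists_nonneg
  refine ⟨|C| * D, r, fun n => (h n).trans ?_⟩
  rw [mul_assoc]
  exact mul_le_mul (le_abs_self C) (hg n) (norm_nonneg _) (abs_nonneg C)

theorem LogBounded.add (hf : LogBounded f) (hg : LogBounded g) : LogBounded (f + g) := by
  obtain ⟨C, r, hC, hf⟩ := hf.exists_nonneg
  obtain ⟨D, q, hD, hg⟩ := hg.exists_nonneg
  refine ⟨C + D, max r q, fun n => ?_⟩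
  have h1 := one_le_harmonicGauge n
  calc ‖f n + g n‖ ≤ ‖f n‖ + ‖g n‖ := norm_add_le _ _
    _ ≤ C * harmonicGauge n ^ r + D * harmonicGauge n ^ q := add_le_add (hf n) (hg n)
    _ ≤ C * harmonicGauge n ^ max r q + D * harmonicGauge n ^ max r q := by
        gcongr
        · exact le_max_left _ _
        · exact le_max_right _ _
    _ = _ := by ring

theorem LogDecaying.of_le {𝕜' : Type*} [NormedField 𝕜'] {g : ℕ → 𝕜'} (hg : LogDecaying g) (C : ℝ)
    (h : ∀ n, ‖f n‖ ≤ C * ‖g n‖) : LogDecaying f := by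
  rw [logDecaying_iff] at *
  refine hg.of_le C fun n => ?_
  have := h n
  have hn : (0 : ℝ) ≤ (n : ℝ) + 1 := by positivity
  simp only [norm_mul, norm_norm, Real.norm_of_nonneg hn]
  nlinarith

theorem LogDecaying.add (hf : LogDecaying f) (hg : LogDecaying g) : LogDecaying (f + g) := by
  rw [logDecaying_iff] at *
  refine (hf.add hg).of_le 1 fun n => ?_
  have hn : (0 : ℝ) ≤ (n : ℝ) + 1 := by positivity
  have h0 : 0 ≤ ((n : ℝ) + 1) * ‖f n‖ + ((n : ℝ) + 1) * ‖g n‖ := by positivity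
  simp only [Pi.add_apply, norm_mul, norm_norm, Real.norm_of_nonneg hn, one_mul,
    Real.norm_of_nonneg h0]
  nlinarith [norm_add_le (f n) (g n)]

theorem LogDecaying.logBounded (hf : LogDecaying f) : LogBounded f := by
  rw [logDecaying_iff] at hf
  refine hf.of_le 1 fun n => ?_
  have hn : (0 : ℝ) ≤ (n : ℝ) + 1 := by positivity
  simp only [norm_mul, norm_norm, Real.norm_of_nonneg hn, one_mul]
  nlinarith [norm_nonneg (f n), (Nat.cast_nonneg n : (0 : ℝ) ≤ n)]

theorem LogDecaying.zero : LogDecaying (0 : ℕ → 𝕜) := ⟨0, 0, fun n => by simp⟩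

theorem LogDecaying.const_mul (hf : LogDecaying f) (c : 𝕜) : LogDecaying fun n => c * f n :=
  hf.of_le ‖c‖ fun n => by simp

theorem LogDecaying.single : LogDecaying (Pi.single 0 1 : ℕ → 𝕜) := by
  refine ⟨1, 0, fun n => ?_⟩
  rcases Nat.eq_zero_or_pos n with rfl | h
  · simp
  · simp only [Pi.single_eq_of_ne h.ne', norm_zero]; positivity

theorem LogDecaying.logBounded_strictSum (hf : LogDecaying f) : LogBounded (strictSum f) := by
  rw [logDecaying_iff] at hf
  obtain ⟨C, r, hC, hf⟩ := hf.exists_nonneg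
  refine ⟨C, r + 1, fun n => ?_⟩
  have hb : ∀ m ∈ Finset.range n, ‖f m‖ ≤ C * harmonicGauge n ^ r * (1 / ((m : ℝ) + 1)) := by
    intro m hm
    have hm0 : (0 : ℝ) < (m : ℝ) + 1 := by positivity
    have h1 := hf m
    have h2 := harmonicGauge_mono (Finset.mem_range.1 hm).le
    have h3 := one_le_harmonicGauge m
    rw [norm_mul, norm_norm, Real.norm_of_nonneg hm0.le] at h1
    rw [mul_one_div, le_div_iff₀ hm0, mul_comm]
    refine h1.trans ?_
    gcongr
  have h4 := one_le_harmonicGauge n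
  calc ‖∑ m ∈ Finset.range n, f m‖ ≤ ∑ m ∈ Finset.range n, ‖f m‖ := norm_sum_le _ _
    _ ≤ ∑ m ∈ Finset.range n, C * harmonicGauge n ^ r * (1 / ((m : ℝ) + 1)) :=
        Finset.sum_le_sum hb
    _ = C * harmonicGauge n ^ r * (harmonicGauge n - 1) := by
        rw [← Finset.mul_sum]; simp [harmonicGauge]
    _ ≤ C * harmonicGauge n ^ r * harmonicGauge n := by
        refine mul_le_mul_of_nonneg_left (by linarith) (by positivity)
    _ = C * harmonicGauge n ^ (r + 1) := by ring

theorem LogDecaying.logBounded_weakSum (hf : LogDecaying f) : LogBounded (weakSum f) := by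
  rw [weakSum_eq]; exact hf.logBounded_strictSum.add hf.logBounded

/-- Division by a linear form turns logarithmic growth into decay. -/
theorem LogBounded.logDecaying_mul {u : ℕ → 𝕜} (hf : LogBounded f) (C : ℝ)
    (hu : ∀ n, ‖u n‖ ≤ C / ((n : ℝ) + 1)) : LogDecaying fun n => u n * f n := by
  rw [logDecaying_iff]
  refine hf.of_le C fun n => ?_
  have hn : (0 : ℝ) < (n : ℝ) + 1 := by positivity
  have := hu n
  rw [le_div_iff₀ hn] at this
  simp only [norm_mul, norm_norm, Real.norm_of_nonneg hn.le]
  nlinarith [norm_nonneg (f n)]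

end Growth

/-! ### Nested sums -/

/-- The nested sum `∑ u_1(n_1) ⋯ u_d(n_d)` over `n_1 ≻ ⋯ ≻ n_d ≻ 0` with `n_1 = n` fixed. For
`d = 0` it is the indicator of `n = 0`, which accounts for the `0` at the end of the chain. -/
def chainSum {𝕜 : Type*} [CommSemiring 𝕜] :
    (d : ℕ) → (Fin d → ℕ → 𝕜) → (Fin d → Bool) → ℕ → 𝕜
  | 0, _, _ => Pi.single 0 1
  | d + 1, u, strict => fun n => u 0 n *
      (if strict 0 then strictSum (chainSum d (Fin.tail u) (Fin.tail strict)) n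
        else weakSum (chainSum d (Fin.tail u) (Fin.tail strict)) n)

/-- The first entry of an index tuple, or `0` if the tuple is empty. -/
def headIndex : (d : ℕ) → (Fin d → ℕ) → ℕ
  | 0, _ => 0
  | _ + 1, n => n 0

theorem map_chainSum {𝕜 𝕜' : Type*} [CommSemiring 𝕜] [CommSemiring 𝕜'] (φ : 𝕜 →+* 𝕜') (d : ℕ)
    (u : Fin d → ℕ → 𝕜) (strict : Fin d → Bool) (n : ℕ) :
    φ (chainSum d u strict n) = chainSum d (fun j n => φ (u j n)) strict n := by
  induction d generalizing n with
  | zero => simp [chainSum, Pi.single_apply, apply_ite φ]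
  | succ d ih =>
    simp only [chainSum, strictSum, weakSum, map_mul, apply_ite φ, map_sum, ih]
    rfl

theorem logDecaying_chainSum {𝕜 : Type*} [NormedField 𝕜] (C : ℝ) (d : ℕ) (u : Fin d → ℕ → 𝕜)
    (strict : Fin d → Bool) (hu : ∀ j n, ‖u j n‖ ≤ C / ((n : ℝ) + 1)) :
    LogDecaying (chainSum d u strict) := by
  induction d with
  | zero => exact LogDecaying.single
  | succ d ih =>
    have h := ih (Fin.tail u) (Fin.tail strict) fun j n => hu j.succ n
    by_cases hs : strict 0
    · simpa only [chainSum, hs, if_true] using h.logBounded_strictSum.logDecaying_mul C (hu 0)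
    · simpa only [chainSum, hs, if_false, Bool.false_eq_true] using
        h.logBounded_weakSum.logDecaying_mul C (hu 0)

theorem nextIndex_succ {d : ℕ} (n : Fin (d + 1) → ℕ) (j : Fin d) :
    nextIndex n j.succ = nextIndex (Fin.tail n) j := by
  simp only [nextIndex, Fin.val_succ, add_lt_add_iff_right, Fin.tail]
  rfl

theorem nextIndex_zero {d : ℕ} (n : Fin (d + 1) → ℕ) :
    nextIndex n 0 = headIndex d (Fin.tail n) := by
  cases d with
  | zero => simp [nextIndex, headIndex]
  | succ d => simp [nextIndex, headIndex, Fin.tail]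

theorem mem_indexRange_succ {d : ℕ} (strict : Fin (d + 1) → Bool) (n : Fin (d + 1) → ℕ) :
    n ∈ indexRange strict ↔
      headIndex d (Fin.tail n) < (if strict 0 then n 0 else n 0 + 1) ∧
        Fin.tail n ∈ indexRange (Fin.tail strict) := by
  simp only [indexRange, Set.mem_ofPred_eq, Fin.forall_fin_succ, nextIndex_zero, nextIndex_succ]
  refine and_congr ?_ Iff.rfl
  split <;> simp

open Classical in
/-- Over the part of the summation range where the first index is `k`, the products sum to
`chainSum`. -/
theorem hasSum_chainSum {𝕜 : Type*} [NormedField 𝕜] (d : ℕ) (u : Fin d → ℕ → 𝕜)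
    (strict : Fin d → Bool) (k : ℕ) :
    HasSum (fun n : Fin d → ℕ =>
      if n ∈ indexRange strict ∧ headIndex d n = k then ∏ j, u j (n j) else 0)
      (chainSum d u strict k) := by
  induction d generalizing k with
  | zero =>
    have h : ∀ n : Fin 0 → ℕ, n ∈ indexRange strict := fun n j => j.elim0
    simp only [h, headIndex, true_and, Finset.univ_eq_empty, Finset.prod_empty, chainSum]
    convert! hasSum_unique (fun _ : Fin 0 → ℕ => if 0 = k then (1 : 𝕜) else 0) using 1
    simp [Pi.single_apply, eq_comm]
  | succ d ih =>
    have hinj : Function.Injective fun m : Fin d → ℕ => (Fin.cons k m : Fin (d + 1) → ℕ) :=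
      Fin.cons_right_injective (α := fun _ => ℕ) k
    rw [← hinj.hasSum_iff]
    · set K := if strict 0 then k else k + 1 with hK
      have h1 : chainSum (d + 1) u strict k =
          u 0 k * ∑ i ∈ Finset.range K, chainSum d (Fin.tail u) (Fin.tail strict) i := by
        simp only [chainSum, hK, strictSum, weakSum]
        split <;> rfl
      rw [h1]
      have h2 := (hasSum_sum fun i (_ : i ∈ Finset.range K) =>
        ih (Fin.tail u) (Fin.tail strict) i).mul_left (u 0 k)
      convert! h2 using 1
      funext m
      simp only [Function.comp_apply, mem_indexRange_succ, Fin.tail_cons, Fin.cons_zero, headIndex,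
        and_true, ← hK, Fin.prod_univ_succ, Fin.cons_succ]
      by_cases hm : m ∈ indexRange (Fin.tail strict)
      · simp only [hm, and_true, true_and]
        rw [Finset.sum_ite_eq, mul_ite, mul_zero]
        simp only [Finset.mem_range]
        rfl
      · simp [hm]
    · intro n hn
      rw [if_neg]
      rintro ⟨-, rfl⟩
      exact hn ⟨Fin.tail n, Fin.cons_self_tail n⟩

/-! ### Power series on the unit disc -/

/-- The sequence is bounded by a power of `n`. -/
def PolyBounded (q : ℕ → ℂ) : Prop :=
  ∃ (C : ℝ) (K : ℕ), 0 ≤ C ∧ ∀ n, ‖q n‖ ≤ C * ((n : ℝ) + 1) ^ K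

/-- The sum of the power series with coefficients `q`. -/
noncomputable def powerSum (q : ℕ → ℂ) (z : ℂ) : ℂ := ∑' n, q n * z ^ n

/-- The coefficients of the derivative of the power series with coefficients `q`. -/
def derivSeq (q : ℕ → ℂ) (n : ℕ) : ℂ := ((n : ℂ) + 1) * q (n + 1)

theorem LogBounded.polyBounded {q : ℕ → ℂ} (hq : LogBounded q) : PolyBounded q := by
  obtain ⟨C, r, hC, h⟩ := hq.exists_nonneg
  refine ⟨C, r, hC, fun n => (h n).trans ?_⟩
  have := one_le_harmonicGauge n
  gcongr
  exact harmonicGauge_le n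

theorem PolyBounded.const_mul {q : ℕ → ℂ} (hq : PolyBounded q) (c : ℂ) :
    PolyBounded fun n => c * q n := by
  obtain ⟨C, K, hC, h⟩ := hq
  refine ⟨‖c‖ * C, K, by positivity, fun n => ?_⟩
  rw [norm_mul, mul_assoc]
  exact mul_le_mul_of_nonneg_left (h n) (norm_nonneg c)

theorem PolyBounded.derivSeq {q : ℕ → ℂ} (hq : PolyBounded q) : PolyBounded (derivSeq q) := by
  obtain ⟨C, K, hC, h⟩ := hq
  refine ⟨C * 2 ^ K, K + 1, by positivity, fun n => ?_⟩
  have hn : ‖((n : ℂ) + 1)‖ = (n : ℝ) + 1 := by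
    rw [← Nat.cast_succ, Complex.norm_natCast]; push_cast; ring
  have hn0 : (0 : ℝ) ≤ n := Nat.cast_nonneg n
  have h1 := h (n + 1)
  push_cast at h1
  calc ‖((n : ℂ) + 1) * q (n + 1)‖ = ((n : ℝ) + 1) * ‖q (n + 1)‖ := by rw [norm_mul, hn]
    _ ≤ ((n : ℝ) + 1) * (C * ((n : ℝ) + 1 + 1) ^ K) := by gcongr
    _ ≤ ((n : ℝ) + 1) * (C * (2 * ((n : ℝ) + 1)) ^ K) := by gcongr; linarith
    _ = C * 2 ^ K * ((n : ℝ) + 1) ^ (K + 1) := by rw [mul_pow]; ring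

theorem PolyBounded.summable_norm {q : ℕ → ℂ} (hq : PolyBounded q) {r : ℝ} (h0 : 0 ≤ r)
    (h1 : r < 1) : Summable fun n => ‖q n‖ * r ^ n := by
  obtain ⟨C, K, hC, h⟩ := hq
  have hO : (fun n : ℕ => (((n : ℝ) + 1) ^ K : ℝ)) =O[Filter.atTop]
      fun n => ((n ^ K : ℕ) : ℝ) := by
    refine Asymptotics.IsBigO.of_bound (2 ^ K) ?_
    filter_upwards [Filter.eventually_ge_atTop 1] with n hn
    have hn' : (1 : ℝ) ≤ n := by exact_mod_cast hn
    rw [Real.norm_of_nonneg (by positivity), Real.norm_of_nonneg (by positivity)]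
    push_cast
    rw [← mul_pow]
    gcongr
    linarith
  have hs : Summable fun n : ℕ => ‖((n : ℝ) + 1) ^ K * r ^ n‖ :=
    summable_norm_mul_geometric_of_norm_lt_one' (by rwa [Real.norm_of_nonneg h0]) hO
  refine Summable.of_nonneg_of_le (fun n => by positivity) (fun n => ?_) (hs.mul_left C)
  rw [Real.norm_of_nonneg (by positivity), ← mul_assoc]
  gcongr
  exact h n

theorem PolyBounded.summable {q : ℕ → ℂ} (hq : PolyBounded q) {z : ℂ} (hz : ‖z‖ < 1) :
    Summable fun n => q n * z ^ n := by
  refine Summable.of_norm ?_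
  simpa only [norm_mul, norm_pow] using hq.summable_norm (norm_nonneg z) hz

theorem powerSum_add {p q : ℕ → ℂ} (hp : PolyBounded p) (hq : PolyBounded q) {z : ℂ}
    (hz : ‖z‖ < 1) : powerSum (p + q) z = powerSum p z + powerSum q z := by
  simp only [powerSum, Pi.add_apply, add_mul]
  exact (hp.summable hz).tsum_add (hq.summable hz)

theorem powerSum_const_mul (q : ℕ → ℂ) (c z : ℂ) :
    powerSum (fun n => c * q n) z = c * powerSum q z := by
  simp only [powerSum, mul_assoc, tsum_mul_left]

theorem powerSum_at_zero (q : ℕ → ℂ) : powerSum q 0 = q 0 := by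
  rw [powerSum, tsum_eq_single 0 fun n hn => by simp [hn]]
  simp

theorem powerSum_single (z : ℂ) : powerSum (Pi.single 0 1) z = 1 := by
  rw [powerSum, tsum_eq_single 0 fun n hn => by simp [hn]]
  simp

/-- Multiplication of a power series by `α + β z`. -/
theorem powerSum_linear_mul {e b : ℕ → ℂ} (he : PolyBounded e) (α β : ℂ) (h0 : b 0 = α * e 0)
    (h : ∀ n, b (n + 1) = α * e (n + 1) + β * e n) {z : ℂ} (hz : ‖z‖ < 1) :
    (α + β * z) * powerSum e z = powerSum b z := by
  have hs := he.summable hz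
  have h1 := (hs.hasSum.mul_left α)
  have h2 := (hs.hasSum.mul_left (β * z))
  rw [← hasSum_nat_add_iff' 1] at h1
  have h3 := h1.add h2
  have h4 : HasSum (fun n => b (n + 1) * z ^ (n + 1))
      (α * ∑' n, e n * z ^ n - ∑ i ∈ Finset.range 1, α * (e i * z ^ i) +
        β * z * ∑' n, e n * z ^ n) := by
    convert! h3 using 1
    funext n
    rw [h]; ring
  have h5 := ((hasSum_nat_add_iff (f := fun n => b n * z ^ n) 1).1 h4).tsum_eq
  rw [powerSum, powerSum, h5]
  simp [h0]
  ring

theorem hasDerivAt_powerSum {q : ℕ → ℂ} (hq : PolyBounded q) {z : ℂ} (hz : ‖z‖ < 1) :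
    HasDerivAt (powerSum q) (powerSum (derivSeq q) z) z := by
  obtain ⟨r, hzr, hr⟩ := exists_between hz
  have hr0 : 0 < r := (norm_nonneg z).trans_lt hzr
  have hsum : Summable fun n : ℕ => ‖q n‖ * (n * r ^ (n - 1)) := by
    rw [← summable_nat_add_iff 1]
    refine (hq.derivSeq.summable_norm hr0.le hr).congr fun n => ?_
    have hn : ‖((n : ℂ) + 1)‖ = (n : ℝ) + 1 := by
      rw [← Nat.cast_succ, Complex.norm_natCast]; push_cast; ring
    simp only [derivSeq, norm_mul, hn, Nat.cast_add, Nat.cast_one, Nat.add_sub_cancel]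
    ring
  have h := hasDerivAt_tsum_of_isPreconnected (t := Metric.ball (0 : ℂ) r) (y₀ := 0) (y := z)
    (g := fun n y => q n * y ^ n) (g' := fun n y => q n * (n * y ^ (n - 1))) hsum
    Metric.isOpen_ball (convex_ball 0 r).isPreconnected
    (fun n y _ => (hasDerivAt_pow n y).const_mul (q n))
    (fun n y hy => by
      rw [norm_mul, norm_mul, Complex.norm_natCast, norm_pow]
      have : ‖y‖ < r := by simpa using hy
      gcongr)
    (by simpa using hr0) (hq.summable (by simp)) (by simpa using hzr)
  convert! h using 1
  have hs : Summable fun n : ℕ => q n * (n * z ^ (n - 1)) := by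
    refine Summable.of_norm_bounded hsum fun n => ?_
    rw [norm_mul, norm_mul, Complex.norm_natCast, norm_pow]
    gcongr
  rw [hs.tsum_eq_zero_add]
  simp only [powerSum, derivSeq]
  simp only [Nat.cast_zero, zero_mul, mul_zero, zero_add, Nat.add_sub_cancel]
  refine tsum_congr fun n => ?_
  push_cast; ring

theorem continuousAt_powerSum {q : ℕ → ℂ} (hq : PolyBounded q) {z : ℂ} (hz : ‖z‖ < 1) :
    ContinuousAt (powerSum q) z := (hasDerivAt_powerSum hq hz).continuousAt

/-- `z F'(z)` has the coefficients `n q n`. -/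
theorem mul_powerSum_derivSeq {q b : ℕ → ℂ} (hq : PolyBounded q) (hb : ∀ n, b n = n * q n) {z : ℂ}
    (hz : ‖z‖ < 1) : z * powerSum (derivSeq q) z = powerSum b z := by
  have := powerSum_linear_mul (b := b) hq.derivSeq 0 1 (by simp [hb])
    (fun n => by simp [hb, derivSeq]) hz
  simpa using this

/-- Two functions with the same derivative on `(0, 1)` and the same value at `0` agree. -/
theorem eq_of_hasDerivAt_eq {F G F' : ℂ → ℂ}
    (hF : ∀ t : ℝ, 0 < t → t < 1 → HasDerivAt F (F' t) t)
    (hG : ∀ t : ℝ, 0 < t → t < 1 → HasDerivAt G (F' t) t)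
    (hF0 : ContinuousAt F 0) (hG0 : ContinuousAt G 0) (h0 : F 0 = G 0) (t : ℝ) (ht0 : 0 < t)
    (ht1 : t < 1) : F t = G t := by
  have hd : ∀ s ∈ Set.Ioo (0 : ℝ) 1, HasDerivAt (fun s : ℝ => F s - G s) 0 s := fun s hs => by
    have := ((hF s hs.1 hs.2).sub (hG s hs.1 hs.2)).comp_ofReal
    simpa using this
  have hconst : ∀ s ∈ Set.Ioo (0 : ℝ) 1, F s - G s = F t - G t := fun s hs =>
    isOpen_Ioo.is_const_of_deriv_eq_zero isPreconnected_Ioo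
      (fun s hs => (hd s hs).differentiableAt.differentiableWithinAt)
      (fun s hs => (hd s hs).deriv) hs ⟨ht0, ht1⟩
  have hlim : Filter.Tendsto (fun s : ℝ => F s - G s) (nhdsWithin 0 (Set.Ioi 0))
      (nhds (F 0 - G 0)) := by
    have hr : Filter.Tendsto (fun s : ℝ => (s : ℂ)) (nhdsWithin 0 (Set.Ioi 0)) (nhds 0) := by
      have := (Complex.continuous_ofReal.tendsto 0).mono_left
        (nhdsWithin_le_nhds (s := Set.Ioi (0 : ℝ)))
      simpa using this
    exact (hF0.tendsto.comp hr).sub (hG0.tendsto.comp hr)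
  have hlim' : Filter.Tendsto (fun s : ℝ => F s - G s) (nhdsWithin 0 (Set.Ioi 0))
      (nhds (F t - G t)) := by
    refine tendsto_const_nhds.congr' ?_
    filter_upwards [Ioo_mem_nhdsGT (zero_lt_one' ℝ)] with s hs using (hconst s hs).symm
  have := tendsto_nhds_unique hlim' hlim
  rw [h0, sub_self] at this
  exact sub_eq_zero.1 this

/-! ### Iterated integrals of multiple polylogarithm type -/

/-- The coefficients of the one-variable multiple polylogarithm
`∑ z_1^{n_1} ⋯ z_d^{n_d} t^{n_1} / (n_1^{s_1} ⋯ n_d^{s_d})` as a power series in `t`. -/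
noncomputable def polylogSeq (d : ℕ) (s : Fin d → ℕ) (z : Fin d → ℂ) : ℕ → ℂ :=
  chainSum d (fun j n => z j ^ n / (n : ℂ) ^ s j) fun _ => true

/-- The rational span of the coefficient sequences of multiple polylogarithms of weight `w` at
fourth roots of unity. -/
noncomputable def polylogSpan (w : ℕ) : Submodule ℚ (ℕ → ℂ) :=
  Submodule.span ℚ {b | ∃ (d : ℕ) (s : Fin d → ℕ) (z : Fin d → ℂ),
    (∀ j, 1 ≤ s j) ∧ (∀ j, z j ^ 4 = 1) ∧ ∑ j, s j = w ∧ b = polylogSeq d s z}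

/-- The part of `polylogSpan` spanned by words whose leading pair is not `(1, 1)`; these converge
at `t = 1`. -/
noncomputable def admissibleSpan (w : ℕ) : Submodule ℚ (ℕ → ℂ) :=
  Submodule.span ℚ {b | ∃ (d : ℕ) (s : Fin d → ℕ) (z : Fin d → ℂ),
    (∀ j, 1 ≤ s j) ∧ (∀ j, z j ^ 4 = 1) ∧ (∀ j : Fin d, (j : ℕ) = 0 → (s j, z j) ≠ (1, 1)) ∧
    ∑ j, s j = w ∧ b = polylogSeq d s z}

theorem admissibleSpan_le (w : ℕ) : admissibleSpan w ≤ polylogSpan w :=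
  Submodule.span_mono fun _ ⟨d, s, z, h1, h2, _, h3, h4⟩ => ⟨d, s, z, h1, h2, h3, h4⟩

/-- Integration of a power series against `dt / t`, the constant term being dropped. -/
noncomputable def intZero : (ℕ → ℂ) →ₗ[ℚ] (ℕ → ℂ) where
  toFun b n := b n / n
  map_add' _ _ := by ext n; simp [add_div]
  map_smul' _ _ := by ext n; simp [Rat.smul_def, mul_div_assoc]

/-- Integration of a power series against `dt / (σ - t)`. -/
noncomputable def intPole (σ : ℂ) : (ℕ → ℂ) →ₗ[ℚ] (ℕ → ℂ) where
  toFun b n := (∑ m ∈ Finset.range n, σ ^ m * b m) / σ ^ n / n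
  map_add' _ _ := by ext n; simp [add_div, mul_add, Finset.sum_add_distrib]
  map_smul' c b := by
    ext n
    simp only [Rat.smul_def, Pi.smul_apply, RingHom.id_apply]
    rw [← mul_div_assoc, ← mul_div_assoc, Finset.mul_sum]
    simp only [mul_left_comm]

theorem intZero_apply (b : ℕ → ℂ) (n : ℕ) : intZero b n = b n / n := rfl

theorem intPole_apply (σ : ℂ) (b : ℕ → ℂ) (n : ℕ) :
    intPole σ b n = (∑ m ∈ Finset.range n, σ ^ m * b m) / σ ^ n / n := rfl

theorem polylogSeq_succ (d : ℕ) (s : Fin (d + 1) → ℕ) (z : Fin (d + 1) → ℂ) (n : ℕ) :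
    polylogSeq (d + 1) s z n =
      z 0 ^ n / (n : ℂ) ^ s 0 * strictSum (polylogSeq d (Fin.tail s) (Fin.tail z)) n := by
  simp only [polylogSeq, chainSum, if_true]
  rfl

theorem norm_eq_one_of_pow_four {z : ℂ} (hz : z ^ 4 = 1) : ‖z‖ = 1 :=
  Complex.norm_eq_one_of_pow_eq_one hz (by norm_num)

theorem ne_zero_of_pow_four {z : ℂ} (hz : z ^ 4 = 1) : z ≠ 0 := by
  rintro rfl; norm_num at hz

theorem logDecaying_polylogSeq (d : ℕ) (s : Fin d → ℕ) (z : Fin d → ℂ) (hs : ∀ j, 1 ≤ s j)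
    (hz : ∀ j, z j ^ 4 = 1) : LogDecaying (polylogSeq d s z) := by
  refine logDecaying_chainSum 2 d _ _ fun j n => ?_
  rw [norm_div, norm_pow, norm_pow, norm_eq_one_of_pow_four (hz j), one_pow, Complex.norm_natCast]
  rcases Nat.eq_zero_or_pos n with rfl | hn
  · simp [(Nat.one_le_iff_ne_zero.1 (hs j))]
  · have hn' : (1 : ℝ) ≤ n := by exact_mod_cast hn
    rw [div_le_div_iff₀ (by positivity) (by positivity)]
    have := le_self_pow₀ hn' (Nat.one_le_iff_ne_zero.1 (hs j))
    linarith

theorem logDecaying_of_mem {w : ℕ} {b : ℕ → ℂ} (hb : b ∈ polylogSpan w) : LogDecaying b := by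
  induction hb using Submodule.span_induction with
  | mem b hb =>
    obtain ⟨d, s, z, hs, hz, -, rfl⟩ := hb
    exact logDecaying_polylogSeq d s z hs hz
  | zero => exact LogDecaying.zero
  | add b c _ _ hb hc => exact hb.add hc
  | smul r b _ hb =>
    convert! hb.const_mul (r : ℂ) using 1

theorem polyBounded_of_mem {w : ℕ} {b : ℕ → ℂ} (hb : b ∈ polylogSpan w) : PolyBounded b :=
  (logDecaying_of_mem hb).logBounded.polyBounded

theorem single_mem_admissibleSpan : (Pi.single 0 1 : ℕ → ℂ) ∈ admissibleSpan 0 :=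
  Submodule.subset_span ⟨0, Fin.elim0, Fin.elim0, fun j => j.elim0, fun j => j.elim0,
    fun j => j.elim0, by simp, rfl⟩

theorem intZero_mem {w : ℕ} {b : ℕ → ℂ} (hb : b ∈ polylogSpan w) :
    intZero b ∈ admissibleSpan (w + 1) := by
  refine (Submodule.map_span_le intZero _ _).2 ?_ (Submodule.mem_map_of_mem hb)
  rintro _ ⟨d, s, z, hs, hz, hw, rfl⟩
  cases d with
  | zero =>
    convert! Submodule.zero_mem _ using 1
    ext n
    rcases Nat.eq_zero_or_pos n with rfl | hn
    · simp [intZero_apply]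
    · simp [intZero_apply, polylogSeq, chainSum, hn.ne']
  | succ d =>
    refine Submodule.subset_span ⟨d + 1, Fin.cons (s 0 + 1) (Fin.tail s), z, ?_, hz, ?_, ?_, ?_⟩
    · refine Fin.cases (by simp) fun j => ?_
      simpa [Fin.tail] using hs j.succ
    · intro j hj
      obtain rfl : j = 0 := Fin.ext hj
      have := hs 0
      simp only [Fin.cons_zero, ne_eq, Prod.mk.injEq, not_and]
      omega
    · rw [Fin.sum_univ_succ] at hw ⊢
      simp only [Fin.cons_zero, Fin.cons_succ, Fin.tail]
      omega
    · ext n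
      rw [intZero_apply, polylogSeq_succ, polylogSeq_succ]
      simp only [Fin.cons_zero, Fin.tail_cons, pow_succ]
      field_simp

/-- Integration against `dt / (σ - t)` prepends the pair `(1, σ⁻¹)` and multiplies the root of
unity that follows by `σ`. -/
theorem exists_intPole_polylogSeq {σ : ℂ} (hσ : σ ^ 4 = 1) (d : ℕ) (s : Fin d → ℕ) (z : Fin d → ℂ)
    (hs : ∀ j, 1 ≤ s j) (hz : ∀ j, z j ^ 4 = 1) :
    ∃ (s' : Fin (d + 1) → ℕ) (z' : Fin (d + 1) → ℂ), (∀ j, 1 ≤ s' j) ∧ (∀ j, z' j ^ 4 = 1) ∧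
      z' 0 = σ⁻¹ ∧ ∑ j, s' j = ∑ j, s j + 1 ∧
      intPole σ (polylogSeq d s z) = polylogSeq (d + 1) s' z' := by
  have hσ' : σ⁻¹ ^ 4 = 1 := by rw [inv_pow, hσ, inv_one]
  cases d with
  | zero =>
    refine ⟨fun _ => 1, fun _ => σ⁻¹, fun _ => le_rfl, fun _ => hσ', rfl, by simp, ?_⟩
    ext n
    rw [intPole_apply, polylogSeq_succ]
    rcases Nat.eq_zero_or_pos n with rfl | hn
    · simp
    · have hn0 : n ≠ 0 := hn.ne'
      simp only [polylogSeq, chainSum, strictSum, Pi.single_apply, mul_ite, mul_one, mul_zero,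
        Finset.sum_ite_eq', Finset.mem_range, hn, if_true, pow_zero, inv_pow, pow_one]
      rw [one_div]
  | succ d =>
    refine ⟨Fin.cons 1 s, Fin.cons σ⁻¹ (Fin.cons (σ * z 0) (Fin.tail z)), ?_, ?_, rfl, ?_, ?_⟩
    · exact Fin.cases (by simp) fun j => by simpa using hs j
    · refine Fin.cases (by simpa using hσ') (Fin.cases ?_ fun j => ?_)
      · simp [mul_pow, hσ, hz 0]
      · simpa [Fin.tail] using hz j.succ
    · rw [Fin.sum_univ_succ, Fin.cons_zero]
      simp only [Fin.cons_succ]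
      omega
    · ext n
      rw [intPole_apply, polylogSeq_succ]
      simp only [Fin.cons_zero, Fin.tail_cons, strictSum, pow_one, inv_pow]
      rw [Finset.sum_congr rfl fun m _ => show σ ^ m * polylogSeq (d + 1) s z m =
        polylogSeq (d + 1) s (Fin.cons (σ * z 0) (Fin.tail z)) m by
          rw [polylogSeq_succ, polylogSeq_succ]
          simp only [Fin.cons_zero, Fin.tail_cons, mul_pow]
          ring]
      ring

theorem intPole_mem {w : ℕ} {b : ℕ → ℂ} (hb : b ∈ polylogSpan w) {σ : ℂ} (hσ : σ ^ 4 = 1) :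
    intPole σ b ∈ polylogSpan (w + 1) := by
  refine (Submodule.map_span_le (intPole σ) _ _).2 ?_ (Submodule.mem_map_of_mem hb)
  rintro _ ⟨d, s, z, hs, hz, hw, rfl⟩
  obtain ⟨s', z', hs', hz', -, hw', h⟩ := exists_intPole_polylogSeq hσ d s z hs hz
  exact Submodule.subset_span ⟨d + 1, s', z', hs', hz', by omega, h⟩

theorem intPole_mem_admissibleSpan {w : ℕ} {b : ℕ → ℂ} (hb : b ∈ polylogSpan w) {σ : ℂ}
    (hσ : σ ^ 4 = 1) (hσ1 : σ ≠ 1) : intPole σ b ∈ admissibleSpan (w + 1) := by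
  refine (Submodule.map_span_le (intPole σ) _ _).2 ?_ (Submodule.mem_map_of_mem hb)
  rintro _ ⟨d, s, z, hs, hz, hw, rfl⟩
  obtain ⟨s', z', hs', hz', hz0, hw', h⟩ := exists_intPole_polylogSeq hσ d s z hs hz
  refine Submodule.subset_span ⟨d + 1, s', z', hs', hz', fun j hj => ?_, by omega, h⟩
  obtain rfl : j = 0 := Fin.ext hj
  simp [hz0, hσ1]

theorem mul_powerSum_intZero {w : ℕ} {b : ℕ → ℂ} (hb : b ∈ polylogSpan w) {z : ℂ} (hz : ‖z‖ < 1) :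
    z * powerSum (derivSeq (intZero b)) z = powerSum b z - b 0 := by
  have h := mul_powerSum_derivSeq (b := b + fun n => -b 0 * (Pi.single 0 1 : ℕ → ℂ) n)
    (polyBounded_of_mem (admissibleSpan_le _ (intZero_mem hb))) (fun n => ?_) hz
  · rw [h, powerSum_add (polyBounded_of_mem hb)
      ((LogDecaying.single.logBounded.polyBounded).const_mul _) hz, powerSum_const_mul,
      powerSum_single]
    ring
  · rcases Nat.eq_zero_or_pos n with rfl | hn
    · simp
    · have : (n : ℂ) ≠ 0 := by exact_mod_cast hn.ne'
      simp only [Pi.add_apply, Pi.single_eq_of_ne hn.ne', mul_zero, add_zero, intZero_apply]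
      field_simp

theorem mul_powerSum_intPole {w : ℕ} {b : ℕ → ℂ} (hb : b ∈ polylogSpan w) {σ : ℂ} (hσ : σ ^ 4 = 1)
    {z : ℂ} (hz : ‖z‖ < 1) : (σ - z) * powerSum (derivSeq (intPole σ b)) z = powerSum b z := by
  have h0 := ne_zero_of_pow_four hσ
  have key : ∀ n, derivSeq (intPole σ b) n =
      (∑ m ∈ Finset.range (n + 1), σ ^ m * b m) / σ ^ (n + 1) := fun n => by
    have : (n : ℂ) + 1 ≠ 0 := by exact_mod_cast Nat.succ_ne_zero n
    rw [derivSeq, intPole_apply]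
    push_cast
    field_simp
  have h := powerSum_linear_mul (b := b) (polyBounded_of_mem (intPole_mem hb hσ)).derivSeq σ (-1)
    (by rw [key]; simp; field_simp) (fun n => ?_) hz
  · rw [← h]; ring
  · rw [key, key, Finset.sum_range_succ _ (n + 1), pow_succ σ (n + 1)]
    field_simp
    ring

/-! ### Convergence at the boundary -/

theorem LogDecaying.tendsto_zero {f : ℕ → ℂ} (hf : LogDecaying f) :
    Filter.Tendsto f Filter.atTop (nhds 0) := by
  rw [logDecaying_iff] at hf
  obtain ⟨C, r, hC, hf⟩ := hf.exists_nonneg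
  obtain ⟨D, hD, h⟩ := exists_harmonicGauge_pow_le r
  have h1 : Filter.Tendsto (fun n : ℕ => C * D * ((n : ℝ) + 1) ^ (-(3 / 4) : ℝ)) Filter.atTop
      (nhds (C * D * 0)) := by
    refine Filter.Tendsto.const_mul _ ?_
    exact (tendsto_rpow_neg_atTop (by norm_num)).comp
      (Filter.tendsto_atTop_add_const_right _ _ tendsto_natCast_atTop_atTop)
  rw [mul_zero] at h1
  refine squeeze_zero_norm (fun n => ?_) h1
  have hn : (0 : ℝ) < (n : ℝ) + 1 := by positivity
  have h2 := hf n
  rw [norm_mul, norm_norm, Real.norm_of_nonneg hn.le] at h2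
  have h3 : ((n : ℝ) + 1) * ((n : ℝ) + 1) ^ (-(3 / 4) : ℝ) = ((n : ℝ) + 1) ^ (1 / 4 : ℝ) := by
    nth_rewrite 1 [← Real.rpow_one ((n : ℝ) + 1)]
    rw [← Real.rpow_add hn]; norm_num
  refine le_of_mul_le_mul_left ?_ hn
  calc ((n : ℝ) + 1) * ‖f n‖ ≤ C * (D * ((n : ℝ) + 1) ^ (1 / 4 : ℝ)) :=
        h2.trans (mul_le_mul_of_nonneg_left (h n) hC)
    _ = _ := by rw [← h3]; ring

theorem LogDecaying.summable_div {f : ℕ → ℂ} (hf : LogDecaying f) :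
    Summable fun n => f n / ((n : ℂ) + 1) := by
  obtain ⟨C, r, hf⟩ := hf
  refine Summable.of_norm_bounded ((summable_harmonicGauge_div_sq r).mul_left C) fun n => ?_
  have hn : ‖((n : ℂ) + 1)‖ = (n : ℝ) + 1 := by
    rw [← Nat.cast_succ, Complex.norm_natCast]; push_cast; ring
  rw [norm_div, hn, ← mul_div_assoc, ← mul_div_assoc]
  exact div_le_div_of_nonneg_right (hf n) (by positivity)

theorem logDecaying_div {h : ℕ → ℂ} (hh : LogBounded h) : LogDecaying fun n => h n / n := by
  have := hh.logDecaying_mul (u := fun n => 1 / (n : ℂ)) 2 fun n => ?_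
  · simpa only [one_div_mul_eq_div] using this
  · rw [norm_div, norm_one, Complex.norm_natCast]
    rcases Nat.eq_zero_or_pos n with rfl | hn
    · simp
    · have hn' : (1 : ℝ) ≤ n := by exact_mod_cast hn
      rw [div_le_div_iff₀ (by positivity) (by positivity)]
      linarith

/-- Summation by parts: `∑ z^n c(n) / n` converges if `z ≠ 1` has modulus `1` and the differences
of `c` are logarithmically decaying. -/
theorem exists_tendsto_sum_strictSum {b : ℕ → ℂ} (hb : LogDecaying b) {z : ℂ} (hz : ‖z‖ = 1)
    (hz1 : z ≠ 1) : ∃ L, Filter.Tendsto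
      (fun N => ∑ n ∈ Finset.range N, z ^ n / n * strictSum b n) Filter.atTop (nhds L) := by
  set f : ℕ → ℂ := fun n => strictSum b n / n with hf
  have hfd : LogDecaying f := logDecaying_div hb.logBounded_strictSum
  have hG : ∀ N, ‖∑ i ∈ Finset.range N, z ^ i‖ ≤ 2 / ‖z - 1‖ := fun N => by
    rw [geom_sum_eq hz1, norm_div]
    gcongr
    refine (norm_sub_le _ _).trans ?_
    rw [norm_pow, hz]; norm_num
  -- this holds also for `i = 0`, where `f 0 = 0` is a junk value
  have hdiff : ∀ i, f (i + 1) - f i = (b i - f i) / ((i : ℂ) + 1) := fun i => by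
    have h1 : (i : ℂ) + 1 ≠ 0 := by exact_mod_cast Nat.succ_ne_zero i
    simp only [hf, strictSum, Finset.sum_range_succ]
    rcases Nat.eq_zero_or_pos i with rfl | hi
    · simp
    · have h2 : (i : ℂ) ≠ 0 := by exact_mod_cast hi.ne'
      push_cast
      field_simp
      ring
  have hs : Summable fun i => (f (i + 1) - f i) • ∑ j ∈ Finset.range (i + 1), z ^ j := by
    have hbf : LogDecaying fun i => b i - f i := by
      have := hb.add (hfd.const_mul (-1))
      convert! this using 1
      funext i; simp [sub_eq_add_neg]
    refine Summable.of_norm_bounded (hbf.summable_div.norm.mul_right (2 / ‖z - 1‖)) fun i => ?_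
    rw [smul_eq_mul, norm_mul, hdiff]
    gcongr
    exact hG _
  have h0 : Filter.Tendsto (fun N => f (N - 1) • ∑ j ∈ Finset.range N, z ^ j) Filter.atTop
      (nhds 0) := by
    have h1 : Filter.Tendsto (fun N => ‖f (N - 1)‖ * (2 / ‖z - 1‖)) Filter.atTop (nhds 0) := by
      have := ((hfd.tendsto_zero.comp (Filter.tendsto_sub_atTop_nat 1)).norm).mul_const
        (2 / ‖z - 1‖)
      simpa using this
    refine squeeze_zero_norm (fun N => ?_) h1
    rw [smul_eq_mul, norm_mul]
    gcongr
    exact hG _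
  have h1 := h0.sub ((hs.hasSum.tendsto_sum_nat).comp (Filter.tendsto_sub_atTop_nat 1))
  refine ⟨_, h1.congr fun N => ?_⟩
  rw [Function.comp_apply, ← Finset.sum_range_by_parts]
  refine Finset.sum_congr rfl fun n _ => ?_
  simp only [hf, smul_eq_mul]
  ring

theorem exists_tendsto_sum_polylogSeq (d : ℕ) (s : Fin d → ℕ) (z : Fin d → ℂ) (hs : ∀ j, 1 ≤ s j)
    (hz : ∀ j, z j ^ 4 = 1) (h : ∀ j : Fin d, (j : ℕ) = 0 → (s j, z j) ≠ (1, 1)) :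
    ∃ L, Filter.Tendsto (fun N => ∑ n ∈ Finset.range N, polylogSeq d s z n) Filter.atTop
      (nhds L) := by
  cases d with
  | zero => exact ⟨1, (hasSum_pi_single (0 : ℕ) (1 : ℂ)).tendsto_sum_nat⟩
  | succ d =>
    have hb := logDecaying_polylogSeq d (Fin.tail s) (Fin.tail z) (fun j => hs j.succ)
      fun j => hz j.succ
    simp only [polylogSeq_succ]
    by_cases h1 : s 0 = 1
    · have hz1 : z 0 ≠ 1 := fun h2 => h 0 rfl (by rw [h1, h2])
      simpa only [h1, pow_one] using
        exists_tendsto_sum_strictSum hb (norm_eq_one_of_pow_four (hz 0)) hz1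
    · have h2 : 2 ≤ s 0 := by have := hs 0; omega
      have hf := (logDecaying_div hb.logBounded_strictSum).summable_div
      have hsum : Summable fun n : ℕ => z 0 ^ n / (n : ℂ) ^ s 0 *
          strictSum (polylogSeq d (Fin.tail s) (Fin.tail z)) n := by
        refine Summable.of_norm_bounded (hf.norm.mul_left 2) fun n => ?_
        have hn : ‖((n : ℂ) + 1)‖ = (n : ℝ) + 1 := by
          rw [← Nat.cast_succ, Complex.norm_natCast]; push_cast; ring
        rw [norm_mul, norm_div, norm_div, norm_div, norm_pow, norm_pow,
          norm_eq_one_of_pow_four (hz 0), one_pow, Complex.norm_natCast, hn]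
        rcases Nat.eq_zero_or_pos n with rfl | hn0
        · simp [strictSum]
        · have hn1 : (1 : ℝ) ≤ n := by exact_mod_cast hn0
          have h3 : (n : ℝ) ^ 2 ≤ (n : ℝ) ^ s 0 := pow_le_pow_right₀ hn1 h2
          have h4 : 1 / (n : ℝ) ^ s 0 ≤ 2 / (n : ℝ) / ((n : ℝ) + 1) := by
            rw [div_div, div_le_div_iff₀ (by positivity) (by positivity)]
            nlinarith
          calc _ ≤ 2 / (n : ℝ) / ((n : ℝ) + 1) * _ :=
                mul_le_mul_of_nonneg_right h4 (norm_nonneg _)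
            _ = _ := by ring
      exact ⟨_, hsum.hasSum.tendsto_sum_nat⟩

theorem headIndex_le_and_mem_iff (d : ℕ) (N : ℕ) (n : Fin d → ℕ) :
    (n ∈ indexRange (fun _ : Fin d => true) ∧ headIndex d n ≤ N) ↔
      ((∀ j, n j ∈ Finset.Icc 1 N) ∧ StrictAnti n) := by
  cases d with
  | zero => simp [indexRange, headIndex, StrictAnti]
  | succ d =>
    simp only [indexRange, if_true, Set.mem_ofPred_eq, headIndex, Finset.mem_Icc]
    constructor
    · rintro ⟨h, hN⟩
      have ha : StrictAnti n := by
        rw [Fin.strictAnti_iff_succ_lt]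
        intro i
        have h1 := h i.castSucc
        have h2 : ((i.castSucc : Fin (d + 1)) : ℕ) + 1 < d + 1 := by simp
        rw [nextIndex, dif_pos h2] at h1
        exact h1
      exact ⟨fun j => ⟨Nat.one_le_iff_ne_zero.2 (Nat.ne_zero_of_lt (h j)),
        (ha.antitone (Fin.zero_le j)).trans hN⟩, ha⟩
    · rintro ⟨h, ha⟩
      refine ⟨fun j => ?_, (h 0).2⟩
      unfold nextIndex
      split_ifs with hj
      · exact ha (Fin.lt_def.2 (Nat.lt_succ_self _))
      · exact (h j).1

theorem polylogPartial_eq (d : ℕ) (s : Fin d → ℕ) (z : Fin d → ℂ) (N : ℕ) :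
    polylogPartial s z N = ∑ n ∈ Finset.range (N + 1), polylogSeq d s z n := by
  classical
  have h1 := hasSum_sum fun k (_ : k ∈ Finset.range (N + 1)) =>
    hasSum_chainSum d (fun j n => z j ^ n / (n : ℂ) ^ s j) (fun _ => true) k
  refine HasSum.unique ?_ h1
  set F := (Fintype.piFinset fun _ : Fin d => Finset.Icc 1 N).filter StrictAnti with hF
  set g : (Fin d → ℕ) → ℂ := fun n => ∏ j, z j ^ n j / (n j : ℂ) ^ s j with hg
  have h2 : ∀ n : Fin d → ℕ, (∑ k ∈ Finset.range (N + 1),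
      if n ∈ indexRange (fun _ : Fin d => true) ∧ headIndex d n = k then g n else 0) =
      if n ∈ F then g n else 0 := fun n => by
    have h3 : n ∈ F ↔ n ∈ indexRange (fun _ : Fin d => true) ∧ headIndex d n ≤ N := by
      rw [hF, Finset.mem_filter, Fintype.mem_piFinset, ← headIndex_le_and_mem_iff d N n]
    simp only [h3]
    by_cases hm : n ∈ indexRange (fun _ : Fin d => true)
    · simp [hm]
    · simp [hm]
  have h4 : HasSum (fun n => if n ∈ F then g n else 0) (∑ n ∈ F, if n ∈ F then g n else 0) :=
    hasSum_sum_of_ne_finset_zero fun n hn => if_neg hn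
  rw [Finset.sum_congr rfl fun n hn => if_pos hn] at h4
  rw [← funext h2] at h4
  exact h4

/-- The partial sums of an admissible sequence converge to a colored multiple zeta value. -/
theorem exists_tendsto_sum_of_mem {w : ℕ} {b : ℕ → ℂ} (hb : b ∈ admissibleSpan w) :
    ∃ L ∈ CMZV w, Filter.Tendsto (fun N => ∑ n ∈ Finset.range N, b n) Filter.atTop (nhds L) := by
  induction hb using Submodule.span_induction with
  | mem b hb =>
    obtain ⟨d, s, z, hs, hz, h, hw, rfl⟩ := hb
    obtain ⟨L, hL⟩ := exists_tendsto_sum_polylogSeq d s z hs hz h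
    refine ⟨L, Submodule.subset_span ⟨d, s, z, hs, hz, h, hw, ?_⟩, hL⟩
    exact (hL.comp (Filter.tendsto_add_atTop_nat 1)).congr fun N => (polylogPartial_eq d s z N).symm
  | zero => exact ⟨0, Submodule.zero_mem _, by simp⟩
  | add b c _ _ hb hc =>
    obtain ⟨L, hL, hb⟩ := hb
    obtain ⟨M, hM, hc⟩ := hc
    refine ⟨L + M, Submodule.add_mem _ hL hM, (hb.add hc).congr fun N => ?_⟩
    simp [Finset.sum_add_distrib]
  | smul r b _ hb =>
    obtain ⟨L, hL, hb⟩ := hb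
    refine ⟨r • L, Submodule.smul_mem _ r hL, (hb.const_smul r).congr fun N => ?_⟩
    simp [Finset.smul_sum]

/-! ### The generating series of an Apéry-type sum -/

/-- The power series `∑ a_n f(n) u^n`. -/
noncomputable def aperySeries (f : ℕ → ℂ) (u : ℂ) : ℂ := powerSum (fun n => aperyCoeff n * f n) u

/-- Division by `2n`; the value at `n = 0` is `0`. -/
noncomputable def divEven (f : ℕ → ℂ) (n : ℕ) : ℂ := f n / (2 * n)

/-- Division by `2n + 1`. -/
noncomputable def divOdd (f : ℕ → ℂ) (n : ℕ) : ℂ := f n / (2 * n + 1)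

/-- The substitution `x = 2t / (1 + t²)`, i.e. `x = sin θ` for `t = tan (θ / 2)`. -/
noncomputable def sinSub (t : ℂ) : ℂ := 2 * t / (1 + t ^ 2)

/-- `√(1 - x²) = (1 - t²) / (1 + t²)` under the substitution `x = 2t / (1 + t²)`. -/
noncomputable def cosSub (t : ℂ) : ℂ := (1 - t ^ 2) / (1 + t ^ 2)

theorem aperyCoeff_zero : aperyCoeff 0 = 1 := by simp [aperyCoeff]

theorem aperyCoeff_succ (n : ℕ) :
    (2 * (n : ℝ) + 2) * aperyCoeff (n + 1) = (2 * n + 1) * aperyCoeff n := by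
  have h : ((n : ℝ) + 1) * (n + 1).centralBinom = 2 * (2 * n + 1) * n.centralBinom := by
    exact_mod_cast Nat.succ_mul_centralBinom_succ n
  unfold aperyCoeff
  rw [pow_succ, ← mul_div_assoc, ← mul_div_assoc, div_eq_div_iff (by positivity) (by positivity)]
  linear_combination (2 * 4 ^ n) * h

theorem aperyCoeff_succ' (n : ℕ) :
    (2 * (n : ℂ) + 2) * aperyCoeff (n + 1) = (2 * n + 1) * aperyCoeff n := by
  exact_mod_cast aperyCoeff_succ n

theorem aperyCoeff_nonneg (n : ℕ) : 0 ≤ aperyCoeff n := by unfold aperyCoeff; positivity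

theorem aperyCoeff_le (n : ℕ) : aperyCoeff n ≤ 1 / √((n : ℝ) + 1) := by
  have key : aperyCoeff n ^ 2 * ((n : ℝ) + 1) ≤ 1 := by
    induction n with
    | zero => simp [aperyCoeff_zero]
    | succ n ih =>
      have h := aperyCoeff_succ n
      have hn : (0 : ℝ) ≤ n := Nat.cast_nonneg n
      have h2 : (2 * (n : ℝ) + 2) ^ 2 * (aperyCoeff (n + 1) ^ 2 * ((n : ℝ) + 1 + 1)) =
          (2 * (n : ℝ) + 1) ^ 2 * ((n : ℝ) + 2) * aperyCoeff n ^ 2 := by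
        rw [← mul_assoc, ← mul_pow, h]; ring
      have h3 : (2 * (n : ℝ) + 1) ^ 2 * ((n : ℝ) + 2) * aperyCoeff n ^ 2 ≤
          (2 * (n : ℝ) + 2) ^ 2 * (aperyCoeff n ^ 2 * ((n : ℝ) + 1)) := by
        nlinarith [mul_nonneg hn (sq_nonneg (aperyCoeff n)), sq_nonneg (aperyCoeff n)]
      push_cast
      refine le_of_mul_le_mul_left ?_ (by positivity : (0 : ℝ) < (2 * (n : ℝ) + 2) ^ 2)
      rw [h2]
      refine h3.trans (mul_le_mul_of_nonneg_left ih (by positivity))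
  have hn : (0 : ℝ) < √((n : ℝ) + 1) := Real.sqrt_pos.2 (by positivity)
  rw [le_div_iff₀ hn]
  refine abs_le_of_sq_le_sq' ?_ zero_le_one |>.2
  rw [mul_pow, Real.sq_sqrt (by positivity)]
  simpa using key

theorem norm_aperyCoeff_le_one (n : ℕ) : ‖(aperyCoeff n : ℂ)‖ ≤ 1 := by
  rw [Complex.norm_real, Real.norm_of_nonneg (aperyCoeff_nonneg n)]
  refine (aperyCoeff_le n).trans ?_
  have h : 1 ≤ √((n : ℝ) + 1) :=
    Real.one_le_sqrt.2 (by linarith [(Nat.cast_nonneg n : (0 : ℝ) ≤ n)])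
  rw [div_le_one (by linarith)]
  exact h

theorem LogDecaying.summable_aperyCoeff_mul {f : ℕ → ℂ} (hf : LogDecaying f) :
    Summable fun n => (aperyCoeff n : ℂ) * f n := by
  obtain ⟨C, r, hf⟩ := hf
  refine Summable.of_norm_bounded ((summable_harmonicGauge_div_mul_sqrt r).mul_left C) fun n => ?_
  rw [norm_mul, Complex.norm_real, Real.norm_of_nonneg (aperyCoeff_nonneg n)]
  calc aperyCoeff n * ‖f n‖ ≤ 1 / √((n : ℝ) + 1) * (C * harmonicGauge n ^ r / ((n : ℝ) + 1)) :=
        mul_le_mul (aperyCoeff_le n) (hf n) (norm_nonneg _) (by positivity)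
    _ = _ := by ring

theorem LogBounded.polyBounded_aperyCoeff_mul {f : ℕ → ℂ} (hf : LogBounded f) :
    PolyBounded fun n => aperyCoeff n * f n := by
  refine (hf.of_le 1 fun n => ?_).polyBounded
  rw [norm_mul]
  exact mul_le_mul_of_nonneg_right (norm_aperyCoeff_le_one n) (norm_nonneg _)

theorem aperySeries_add {f g : ℕ → ℂ} (hf : LogBounded f) (hg : LogBounded g) {u : ℂ}
    (hu : ‖u‖ < 1) : aperySeries (f + g) u = aperySeries f u + aperySeries g u := by
  have := powerSum_add hf.polyBounded_aperyCoeff_mul hg.polyBounded_aperyCoeff_mul hu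
  rw [aperySeries, aperySeries, aperySeries, ← this]
  congr 1
  ext n
  simp [mul_add]

theorem aperySeries_smul (c : ℚ) (f : ℕ → ℂ) (u : ℂ) :
    aperySeries (c • f) u = c * aperySeries f u := by
  rw [aperySeries, aperySeries, ← powerSum_const_mul]
  congr 1
  ext n
  simp [Rat.smul_def, mul_left_comm]

theorem powerSum_smul (c : ℚ) (b : ℕ → ℂ) (z : ℂ) : powerSum (c • b) z = c * powerSum b z := by
  rw [← powerSum_const_mul]
  congr 1

theorem LogBounded.divEven {h : ℕ → ℂ} (hh : LogBounded h) : LogDecaying (divEven h) :=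
  (logDecaying_div hh).of_le 1 fun n => by
    rw [_root_.divEven, div_mul_eq_div_div_swap, norm_div _ (2 : ℂ), one_mul]
    have : ‖(2 : ℂ)‖ = 2 := by simp
    rw [this]
    linarith [norm_nonneg (h n / n)]

theorem two_mul_natCast_add_one_ne_zero (n : ℕ) : (2 * (n : ℂ) + 1) ≠ 0 := by
  exact_mod_cast Nat.succ_ne_zero (2 * n)

theorem LogBounded.divOdd {h : ℕ → ℂ} (hh : LogBounded h) : LogDecaying (divOdd h) := by
  have := hh.logDecaying_mul (u := fun n => 1 / (2 * (n : ℂ) + 1)) 1 fun n => ?_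
  · convert! this using 1
    ext n; simp [_root_.divOdd, div_eq_inv_mul]
  · have hn : ‖(2 * (n : ℂ) + 1)‖ = 2 * n + 1 := by
      have : ((2 * n + 1 : ℕ) : ℂ) = 2 * (n : ℂ) + 1 := by push_cast; ring
      rw [← this, Complex.norm_natCast]; push_cast; ring
    rw [norm_div, norm_one, hn]
    exact div_le_div_of_nonneg_left zero_le_one (by positivity)
      (by linarith [(Nat.cast_nonneg n : (0 : ℝ) ≤ n)])

/-- The differential equation behind partial summation: since `(2n + 2) a_{n+1} = (2n + 1) a_n`, the
derivative of `√(1 - u) ∑ a_n g(n) u^n` depends only on the differences of `g`. -/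
theorem two_mul_one_sub_mul_powerSum_derivSeq {g r : ℕ → ℂ} (hg : LogBounded g)
    (hr : PolyBounded r)
    (h : ∀ n, r n = (2 * (n : ℂ) + 2) * aperyCoeff (n + 1) * (g (n + 1) - g n)) {u : ℂ}
    (hu : ‖u‖ < 1) :
    2 * (1 - u) * powerSum (derivSeq fun n => aperyCoeff n * g n) u =
      aperySeries g u + powerSum r u := by
  have h1 := powerSum_linear_mul (b := (fun n => aperyCoeff n * g n) + r)
    hg.polyBounded_aperyCoeff_mul.derivSeq 2 (-2) ?_ (fun n => ?_) hu
  · rw [aperySeries, ← powerSum_add hg.polyBounded_aperyCoeff_mul hr hu, ← h1]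
    ring
  · have h0 := aperyCoeff_succ' 0
    simp only [Nat.cast_zero, mul_zero, zero_add, aperyCoeff_zero] at h0
    simp only [Pi.add_apply, h, derivSeq, aperyCoeff_zero, Nat.cast_zero, mul_zero, zero_add]
    push_cast at h0 ⊢
    linear_combination (-g 0) * h0
  · have h0 := aperyCoeff_succ' (n + 1)
    simp only [Pi.add_apply, h, derivSeq]
    push_cast at h0 ⊢
    linear_combination (-g (n + 1)) * h0

theorem two_mul_powerSum_derivSeq_divEven {h : ℕ → ℂ} (hh : LogBounded h) (h0 : h 0 = 0) {u : ℂ}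
    (hu : ‖u‖ < 1) :
    2 * u * powerSum (derivSeq fun n => aperyCoeff n * divEven h n) u = aperySeries h u := by
  have := mul_powerSum_derivSeq (b := fun n => (1 / 2) * (aperyCoeff n * h n))
    hh.divEven.logBounded.polyBounded_aperyCoeff_mul (fun n => ?_) hu
  · rw [mul_assoc, this, powerSum_const_mul, aperySeries]
    ring
  · rcases Nat.eq_zero_or_pos n with rfl | hn
    · simp [h0]
    · have : (n : ℂ) ≠ 0 := by exact_mod_cast hn.ne'
      simp only [divEven]
      field_simp

theorem two_mul_powerSum_derivSeq_divOdd {h : ℕ → ℂ} (hh : LogBounded h) {u : ℂ}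
    (hu : ‖u‖ < 1) :
    2 * u * powerSum (derivSeq fun n => aperyCoeff n * divOdd h n) u + aperySeries (divOdd h) u =
      aperySeries h u := by
  have hp := hh.divOdd.logBounded.polyBounded_aperyCoeff_mul
  have h1 := mul_powerSum_derivSeq (b := fun n => n * (aperyCoeff n * divOdd h n))
    hp (fun n => rfl) hu
  have h2 : PolyBounded fun n => (n : ℂ) * (aperyCoeff n * divOdd h n) := by
    refine (hh.of_le 1 fun n => ?_).polyBounded
    have hn : ‖(2 * (n : ℂ) + 1)‖ = 2 * n + 1 := by
      have : ((2 * n + 1 : ℕ) : ℂ) = 2 * (n : ℂ) + 1 := by push_cast; ring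
      rw [← this, Complex.norm_natCast]; push_cast; ring
    rw [norm_mul, norm_mul, divOdd, norm_div, hn, Complex.norm_natCast, ← mul_div_assoc,
      ← mul_div_assoc, div_le_iff₀ (by positivity)]
    have h3 : ‖(aperyCoeff n : ℂ)‖ * ‖h n‖ ≤ ‖h n‖ := by
      nlinarith [norm_aperyCoeff_le_one n, norm_nonneg (h n)]
    nlinarith [norm_nonneg (h n), (Nat.cast_nonneg n : (0 : ℝ) ≤ n),
      mul_le_mul_of_nonneg_left h3 (Nat.cast_nonneg (α := ℝ) n)]
  rw [mul_assoc, h1, aperySeries, ← powerSum_const_mul, ← powerSum_add (h2.const_mul 2) hp hu,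
    aperySeries]
  congr 1
  ext n
  have := two_mul_natCast_add_one_ne_zero n
  simp only [Pi.add_apply, divOdd]
  field_simp

/-! ### The rationalizing substitution -/

section Substitution

variable {t : ℝ}

theorem one_add_sq_ne_zero (t : ℝ) : (1 + (t : ℂ) ^ 2) ≠ 0 := by
  have : (1 + t ^ 2 : ℝ) ≠ 0 := by positivity
  exact_mod_cast this

theorem one_sub_sq_ne_zero (h0 : 0 < t) (h1 : t < 1) : (1 - (t : ℂ) ^ 2) ≠ 0 := by
  have : (1 - t ^ 2 : ℝ) ≠ 0 := by nlinarith
  exact_mod_cast this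

theorem ofReal_pos_ne_zero (h0 : 0 < t) : (t : ℂ) ≠ 0 := by exact_mod_cast h0.ne'

theorem norm_ofReal_lt_one (h0 : 0 < t) (h1 : t < 1) : ‖(t : ℂ)‖ < 1 := by
  rwa [Complex.norm_real, Real.norm_of_nonneg h0.le]

theorem norm_sinSub_sq_lt_one (h0 : 0 < t) (h1 : t < 1) : ‖sinSub t ^ 2‖ < 1 := by
  have h : sinSub t ^ 2 = ((2 * t / (1 + t ^ 2)) ^ 2 : ℝ) := by simp [sinSub]
  rw [h, Complex.norm_real, Real.norm_of_nonneg (by positivity)]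
  refine pow_lt_one₀ (by positivity) ?_ two_ne_zero
  rw [div_lt_one (by positivity)]
  nlinarith [sq_pos_of_pos (sub_pos.2 h1)]

theorem hasDerivAt_sinSub (t : ℝ) :
    HasDerivAt sinSub (2 * (1 - (t : ℂ) ^ 2) / (1 + (t : ℂ) ^ 2) ^ 2) t := by
  have h := ((hasDerivAt_id (t : ℂ)).const_mul 2).div
    (((hasDerivAt_id (t : ℂ)).pow 2).const_add 1) (one_add_sq_ne_zero t)
  convert! h using 1
  simp
  ring

theorem hasDerivAt_cosSub (t : ℝ) :
    HasDerivAt cosSub (-(4 * (t : ℂ)) / (1 + (t : ℂ) ^ 2) ^ 2) t := by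
  have h := (((hasDerivAt_id (t : ℂ)).pow 2).const_sub 1).div
    (((hasDerivAt_id (t : ℂ)).pow 2).const_add 1) (one_add_sq_ne_zero t)
  convert! h using 1
  simp
  ring

theorem hasDerivAt_aperySeries_sinSub {g : ℕ → ℂ} (hg : LogBounded g) (h0 : 0 < t) (h1 : t < 1) :
    HasDerivAt (fun z => aperySeries g (sinSub z ^ 2))
      (powerSum (derivSeq fun n => aperyCoeff n * g n) (sinSub t ^ 2) *
        (2 * sinSub t * (2 * (1 - (t : ℂ) ^ 2) / (1 + (t : ℂ) ^ 2) ^ 2))) t := by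
  have h := (hasDerivAt_powerSum hg.polyBounded_aperyCoeff_mul
    (norm_sinSub_sq_lt_one h0 h1)).comp (t : ℂ) ((hasDerivAt_sinSub t).pow 2)
  convert! h using 1
  simp

theorem continuousAt_aperySeries_sinSub {g : ℕ → ℂ} (hg : LogBounded g) :
    ContinuousAt (fun z => aperySeries g (sinSub z ^ 2)) 0 := by
  have h1 : ContinuousAt (fun z => sinSub z ^ 2) 0 := by
    have := ((hasDerivAt_sinSub 0).pow 2).continuousAt
    rw [Complex.ofReal_zero] at this
    exact this
  refine ContinuousAt.comp (f := fun z => sinSub z ^ 2) (x := 0) ?_ h1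
  exact continuousAt_powerSum hg.polyBounded_aperyCoeff_mul (by simp [sinSub])

theorem continuousAt_sinSub : ContinuousAt sinSub 0 := by
  simpa using (hasDerivAt_sinSub 0).continuousAt

theorem continuousAt_cosSub : ContinuousAt cosSub 0 := by
  simpa using (hasDerivAt_cosSub 0).continuousAt

theorem aperySeries_sinSub_zero (g : ℕ → ℂ) : aperySeries g (sinSub 0 ^ 2) = g 0 := by
  have : sinSub 0 ^ 2 = 0 := by simp [sinSub]
  rw [this, aperySeries, powerSum_at_zero, aperyCoeff_zero]
  simp

theorem cosSub_zero : cosSub 0 = 1 := by simp [cosSub]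

theorem hasDerivAt_cosSub_mul_aperySeries {g r : ℕ → ℂ} (hg : LogBounded g) (hr : PolyBounded r)
    (h : ∀ n, r n = (2 * (n : ℂ) + 2) * aperyCoeff (n + 1) * (g (n + 1) - g n)) (h0 : 0 < t)
    (h1 : t < 1) :
    HasDerivAt (fun z => cosSub z * aperySeries g (sinSub z ^ 2))
      (4 * t / (1 + (t : ℂ) ^ 2) ^ 2 * powerSum r (sinSub t ^ 2)) t := by
  have key := two_mul_one_sub_mul_powerSum_derivSeq hg hr h (norm_sinSub_sq_lt_one h0 h1)
  have hd := (hasDerivAt_cosSub t).mul (hasDerivAt_aperySeries_sinSub hg h0 h1)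
  convert! hd using 1
  have hne := one_add_sq_ne_zero t
  have hk : powerSum r (sinSub t ^ 2) = 2 * (1 - sinSub t ^ 2) *
      powerSum (derivSeq fun n => aperyCoeff n * g n) (sinSub t ^ 2) -
        aperySeries g (sinSub t ^ 2) := by rw [key]; ring
  have hx : 1 - sinSub t ^ 2 = cosSub t ^ 2 := by
    simp only [sinSub, cosSub]; field_simp; ring
  rw [hk, hx]
  generalize powerSum (derivSeq fun n => aperyCoeff n * g n) (sinSub t ^ 2) = P
  generalize aperySeries g (sinSub t ^ 2) = Q
  simp only [sinSub, cosSub]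
  field_simp
  ring

/-- In the variable `t` the forms `dx / x` and `dx / (x √(1 - x²))` govern division by `2n` and the
summation that follows it. -/
theorem hasDerivAt_aperySeries_divEven {h : ℕ → ℂ} (hh : LogBounded h) (hz : h 0 = 0) (h0 : 0 < t)
    (h1 : t < 1) :
    HasDerivAt (fun z => aperySeries (divEven h) (sinSub z ^ 2))
      ((1 - (t : ℂ) ^ 2) / (t * (1 + (t : ℂ) ^ 2)) * aperySeries h (sinSub t ^ 2)) t := by
  have hd := hasDerivAt_aperySeries_sinSub hh.divEven.logBounded h0 h1
  convert! hd using 1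
  rw [← two_mul_powerSum_derivSeq_divEven hh hz (norm_sinSub_sq_lt_one h0 h1)]
  have hne := one_add_sq_ne_zero t
  have ht := ofReal_pos_ne_zero h0
  generalize powerSum (derivSeq fun n => aperyCoeff n * divEven h n) (sinSub t ^ 2) = P
  simp only [sinSub]
  field_simp

theorem hasDerivAt_cosSub_mul_weakSum_divEven {h : ℕ → ℂ} (hh : LogBounded h) (hz : h 0 = 0)
    (h0 : 0 < t) (h1 : t < 1) :
    HasDerivAt (fun z => cosSub z * aperySeries (weakSum (divEven h)) (sinSub z ^ 2))
      (aperySeries h (sinSub t ^ 2) / t) t := by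
  have hp := hh.divEven.logBounded.polyBounded_aperyCoeff_mul.derivSeq.const_mul 2
  have hd := hasDerivAt_cosSub_mul_aperySeries hh.divEven.logBounded_weakSum hp (fun n => by
    simp only [derivSeq, weakSum, Finset.sum_range_succ _ (n + 1)]
    ring) h0 h1
  convert! hd using 1
  rw [powerSum_const_mul,
    ← two_mul_powerSum_derivSeq_divEven hh hz (norm_sinSub_sq_lt_one h0 h1)]
  have hne := one_add_sq_ne_zero t
  have ht := ofReal_pos_ne_zero h0
  generalize powerSum (derivSeq fun n => aperyCoeff n * divEven h n) (sinSub t ^ 2) = P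
  simp only [sinSub]
  field_simp
  ring

theorem hasDerivAt_sinSub_mul_aperySeries_divOdd {h : ℕ → ℂ} (hh : LogBounded h) (h0 : 0 < t)
    (h1 : t < 1) :
    HasDerivAt (fun z => sinSub z * aperySeries (divOdd h) (sinSub z ^ 2))
      (2 * (1 - (t : ℂ) ^ 2) / (1 + (t : ℂ) ^ 2) ^ 2 * aperySeries h (sinSub t ^ 2)) t := by
  have hd := (hasDerivAt_sinSub t).mul (hasDerivAt_aperySeries_sinSub hh.divOdd.logBounded h0 h1)
  convert! hd using 1
  rw [← two_mul_powerSum_derivSeq_divOdd hh (norm_sinSub_sq_lt_one h0 h1)]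
  ring

theorem hasDerivAt_cosSub_mul_strictSum_divOdd {h : ℕ → ℂ} (hh : LogBounded h) (h0 : 0 < t)
    (h1 : t < 1) :
    HasDerivAt (fun z => cosSub z * aperySeries (strictSum (divOdd h)) (sinSub z ^ 2))
      (4 * t / (1 + (t : ℂ) ^ 2) ^ 2 * aperySeries h (sinSub t ^ 2)) t := by
  refine hasDerivAt_cosSub_mul_aperySeries hh.divOdd.logBounded_strictSum
    hh.polyBounded_aperyCoeff_mul (fun n => ?_) h0 h1
  have := two_mul_natCast_add_one_ne_zero n
  rw [aperyCoeff_succ']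
  simp only [strictSum, Finset.sum_range_succ, divOdd]
  field_simp
  ring

end Substitution

/-! ### Sums over pure words -/

/-- `b` is a rational combination of multiple polylogarithms of weight `w` whose power series
vanishes at `0` and has derivative `φ` on `(0, 1)`. -/
structure HasPrimitive (w : ℕ) (b : ℕ → ℂ) (φ : ℝ → ℂ) : Prop where
  mem : b ∈ polylogSpan w
  zero : b 0 = 0
  deriv : ∀ t : ℝ, 0 < t → t < 1 → HasDerivAt (powerSum b) (φ t) t

theorem HasPrimitive.add {w : ℕ} {b c : ℕ → ℂ} {φ ψ : ℝ → ℂ} (hb : HasPrimitive w b φ)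
    (hc : HasPrimitive w c ψ) : HasPrimitive w (b + c) fun t => φ t + ψ t := by
  refine ⟨Submodule.add_mem _ hb.mem hc.mem, by simp [hb.zero, hc.zero], fun t h0 h1 => ?_⟩
  refine ((hb.deriv t h0 h1).add (hc.deriv t h0 h1)).congr_of_eventuallyEq ?_
  have : Metric.ball (0 : ℂ) 1 ∈ nhds (t : ℂ) :=
    Metric.isOpen_ball.mem_nhds (by simpa using norm_ofReal_lt_one h0 h1)
  filter_upwards [this] with z hz
  exact powerSum_add (polyBounded_of_mem hb.mem) (polyBounded_of_mem hc.mem) (by simpa using hz)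

theorem HasPrimitive.neg {w : ℕ} {b : ℕ → ℂ} {φ : ℝ → ℂ} (hb : HasPrimitive w b φ) :
    HasPrimitive w (-b) fun t => -φ t := by
  refine ⟨Submodule.neg_mem _ hb.mem, by simp [hb.zero], fun t h0 h1 => ?_⟩
  have : powerSum (-b) = -powerSum b := by
    ext z
    simp [powerSum, tsum_neg]
  rw [this]
  exact (hb.deriv t h0 h1).neg

theorem HasPrimitive.sub {w : ℕ} {b c : ℕ → ℂ} {φ ψ : ℝ → ℂ} (hb : HasPrimitive w b φ)
    (hc : HasPrimitive w c ψ) : HasPrimitive w (b - c) fun t => φ t - ψ t := by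
  simpa only [sub_eq_add_neg] using hb.add hc.neg

theorem hasPrimitive_intZero {w : ℕ} {b : ℕ → ℂ} (hb : b ∈ polylogSpan w) :
    HasPrimitive (w + 1) (intZero b) fun t => (powerSum b t - b 0) / t := by
  have hm := admissibleSpan_le _ (intZero_mem hb)
  refine ⟨hm, by simp [intZero_apply], fun t h0 h1 => ?_⟩
  have ht := ofReal_pos_ne_zero h0
  convert! hasDerivAt_powerSum (polyBounded_of_mem hm) (norm_ofReal_lt_one h0 h1) using 1
  rw [← mul_powerSum_intZero hb (norm_ofReal_lt_one h0 h1)]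
  field_simp

theorem hasPrimitive_intPole {w : ℕ} {b : ℕ → ℂ} (hb : b ∈ polylogSpan w) {σ : ℂ}
    (hσ : σ ^ 4 = 1) : HasPrimitive (w + 1) (intPole σ b) fun t => powerSum b t / (σ - t) := by
  have hm := intPole_mem hb hσ
  refine ⟨hm, by simp [intPole_apply], fun t h0 h1 => ?_⟩
  have ht : σ - t ≠ 0 := by
    intro h
    have h2 := norm_ofReal_lt_one h0 h1
    rw [← sub_eq_zero.1 h, norm_eq_one_of_pow_four hσ] at h2
    exact lt_irrefl _ h2
  convert! hasDerivAt_powerSum (polyBounded_of_mem hm) (norm_ofReal_lt_one h0 h1) using 1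
  rw [← mul_powerSum_intPole hb hσ (norm_ofReal_lt_one h0 h1)]
  field_simp

/-- Integration against `-2t dt / (1 + t²) = dx / x - dt / t`. -/
noncomputable def intImag (b : ℕ → ℂ) : ℕ → ℂ := intPole Complex.I b + intPole (-Complex.I) b

/-- Integration against `-i dx / √(1 - x²) = -2i dt / (1 + t²)`. -/
noncomputable def intArc (b : ℕ → ℂ) : ℕ → ℂ := intPole Complex.I b - intPole (-Complex.I) b

/-- Integration against `2t dt / (1 - t²)`. -/
noncomputable def intReal (b : ℕ → ℂ) : ℕ → ℂ := intPole 1 b + intPole (-1) b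

theorem neg_I_pow_four : (-Complex.I) ^ 4 = 1 := by
  rw [Even.neg_pow (by decide), Complex.I_pow_four]

theorem I_ne_one : Complex.I ≠ 1 := fun h => by
  have := congrArg Complex.re h; simp at this

theorem neg_I_ne_one : -Complex.I ≠ 1 := fun h => by
  have := congrArg Complex.re h; simp at this

theorem intImag_mem {w : ℕ} {b : ℕ → ℂ} (hb : b ∈ polylogSpan w) :
    intImag b ∈ admissibleSpan (w + 1) :=
  Submodule.add_mem _ (intPole_mem_admissibleSpan hb Complex.I_pow_four I_ne_one)
    (intPole_mem_admissibleSpan hb neg_I_pow_four neg_I_ne_one)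

theorem intArc_mem {w : ℕ} {b : ℕ → ℂ} (hb : b ∈ polylogSpan w) :
    intArc b ∈ admissibleSpan (w + 1) :=
  Submodule.sub_mem _ (intPole_mem_admissibleSpan hb Complex.I_pow_four I_ne_one)
    (intPole_mem_admissibleSpan hb neg_I_pow_four neg_I_ne_one)

theorem I_sub_mul (t : ℂ) : (Complex.I - t) * (-Complex.I - t) = 1 + t ^ 2 := by
  linear_combination (-1 : ℂ) * Complex.I_mul_I

theorem HasPrimitive.congr {w : ℕ} {b : ℕ → ℂ} {φ ψ : ℝ → ℂ} (hb : HasPrimitive w b φ)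
    (h : ∀ t : ℝ, 0 < t → t < 1 → φ t = ψ t) : HasPrimitive w b ψ :=
  ⟨hb.mem, hb.zero, fun t h0 h1 => h t h0 h1 ▸ hb.deriv t h0 h1⟩

theorem I_sub_ne_zero (t : ℝ) : Complex.I - t ≠ 0 ∧ -Complex.I - t ≠ 0 := by
  have h := one_add_sq_ne_zero t
  rw [← I_sub_mul] at h
  exact ⟨left_ne_zero_of_mul h, right_ne_zero_of_mul h⟩

theorem hasPrimitive_intImag {w : ℕ} {b : ℕ → ℂ} (hb : b ∈ polylogSpan w) :
    HasPrimitive (w + 1) (intImag b) fun t => -(2 * t / (1 + (t : ℂ) ^ 2)) * powerSum b t := by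
  refine ((hasPrimitive_intPole hb Complex.I_pow_four).add
    (hasPrimitive_intPole hb neg_I_pow_four)).congr fun t _ _ => ?_
  obtain ⟨h1, h2⟩ := I_sub_ne_zero t
  rw [← I_sub_mul]
  field_simp
  ring

theorem hasPrimitive_intArc {w : ℕ} {b : ℕ → ℂ} (hb : b ∈ polylogSpan w) :
    HasPrimitive (w + 1) (intArc b) fun t =>
      -(2 * Complex.I) / (1 + (t : ℂ) ^ 2) * powerSum b t := by
  refine ((hasPrimitive_intPole hb Complex.I_pow_four).sub
    (hasPrimitive_intPole hb neg_I_pow_four)).congr fun t _ _ => ?_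
  obtain ⟨h1, h2⟩ := I_sub_ne_zero t
  rw [← I_sub_mul]
  field_simp
  ring

theorem hasPrimitive_intReal {w : ℕ} {b : ℕ → ℂ} (hb : b ∈ polylogSpan w) :
    HasPrimitive (w + 1) (intReal b) fun t => 2 * t / (1 - (t : ℂ) ^ 2) * powerSum b t := by
  refine ((hasPrimitive_intPole hb (one_pow 4)).add
    (hasPrimitive_intPole hb (by norm_num : (-1 : ℂ) ^ 4 = 1))).congr fun t h0 h1 => ?_
  have h := one_sub_sq_ne_zero h0 h1
  have h2 : (1 - (t : ℂ) ^ 2) = (1 - t) * (1 + t) := by ring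
  rw [h2] at h ⊢
  have h3 := left_ne_zero_of_mul h
  have h4 := right_ne_zero_of_mul h
  have h5 : (-1 - (t : ℂ)) = -(1 + t) := by ring
  rw [h5]
  field_simp
  ring

/-- The sequences obtained from pure words: `PureSeq false k` and `PureSeq true k` contain the
sequences of weight `k` whose last operation is the division by `2n`, respectively by `2n + 1`.
Between two divisions there may be a partial summation; only those summations are admitted that
keep the generating series an iterated integral of pure weight. -/
inductive PureSeq : Bool → ℕ → (ℕ → ℂ) → Prop
  | zero (p : Bool) (k : ℕ) : PureSeq p k 0
  | add {p : Bool} {k : ℕ} {f g : ℕ → ℂ} : PureSeq p k f → PureSeq p k g → PureSeq p k (f + g)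
  | smul {p : Bool} {k : ℕ} {f : ℕ → ℂ} (c : ℚ) : PureSeq p k f → PureSeq p k (c • f)
  | single : PureSeq false 0 (Pi.single 0 1)
  | even_even {k : ℕ} {f : ℕ → ℂ} :
      PureSeq false k f → f 0 = 0 → PureSeq false (k + 1) (divEven f)
  | even_strict {p : Bool} {k : ℕ} {f : ℕ → ℂ} :
      PureSeq p k f → PureSeq false (k + 1) (divEven (strictSum f))
  | odd_odd {k : ℕ} {f : ℕ → ℂ} : PureSeq true k f → PureSeq true (k + 1) (divOdd f)
  | odd_weak {k : ℕ} {f : ℕ → ℂ} : PureSeq false k f → PureSeq true (k + 1) (divOdd (weakSum f))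
  | odd_strict {k : ℕ} {f : ℕ → ℂ} : PureSeq true k f → PureSeq true (k + 1) (divOdd (strictSum f))

/-- A numerator to be divided by `2n`: with `x = sinSub t`, its generating series in `x²` is
`A + C / √(1 - x²)` for polylogarithms `A`, `C` of weight `k`. -/
structure EvenNumerator (k : ℕ) (h : ℕ → ℂ) : Prop where
  logBounded : LogBounded h
  zero : h 0 = 0
  series : ∃ A ∈ polylogSpan k, ∃ C ∈ polylogSpan k, A 0 + C 0 = 0 ∧
    ∀ t : ℝ, 0 < t → t < 1 →
      aperySeries h (sinSub t ^ 2) = powerSum A t + powerSum C t / cosSub t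

/-- A numerator to be divided by `2n + 1`: with `x = sinSub t`, its generating series in `x²` is
`i B / x + C / √(1 - x²)` for polylogarithms `B`, `C` of weight `k`. -/
structure OddNumerator (k : ℕ) (h : ℕ → ℂ) : Prop where
  logBounded : LogBounded h
  series : ∃ B ∈ polylogSpan k, ∃ C ∈ polylogSpan k, B 0 = 0 ∧
    ∀ t : ℝ, 0 < t → t < 1 →
      sinSub t * aperySeries h (sinSub t ^ 2) =
        Complex.I * powerSum B t + sinSub t * (powerSum C t / cosSub t)

/-- The evaluation of the generating series of `f` and of its partial sums, for a sequence whose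
last operation is the division by `2n`. -/
structure EvenValue (k : ℕ) (f : ℕ → ℂ) : Prop where
  logDecaying : LogDecaying f
  series : ∃ b ∈ admissibleSpan k, b 0 = f 0 ∧
    ∀ t : ℝ, 0 < t → t < 1 → aperySeries f (sinSub t ^ 2) = powerSum b t
  weak : ∃ C ∈ polylogSpan k, C 0 = f 0 ∧
    ∀ t : ℝ, 0 < t → t < 1 →
      cosSub t * aperySeries (weakSum f) (sinSub t ^ 2) = powerSum C t

/-- The evaluation of the generating series of `f` and of its partial sums, for a sequence whose
last operation is the division by `2n + 1`. -/
structure OddValue (k : ℕ) (f : ℕ → ℂ) : Prop where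
  logDecaying : LogDecaying f
  series : ∃ b ∈ admissibleSpan k, b 0 = 0 ∧
    ∀ t : ℝ, 0 < t → t < 1 →
      sinSub t * aperySeries f (sinSub t ^ 2) = Complex.I * powerSum b t
  strict : ∃ C ∈ polylogSpan k, C 0 = 0 ∧
    ∀ t : ℝ, 0 < t → t < 1 →
      cosSub t * aperySeries (strictSum f) (sinSub t ^ 2) = powerSum C t

theorem cosSub_ne_zero {t : ℝ} (h0 : 0 < t) (h1 : t < 1) : cosSub t ≠ 0 :=
  div_ne_zero (one_sub_sq_ne_zero h0 h1) (one_add_sq_ne_zero t)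

theorem sinSub_ne_zero {t : ℝ} (h0 : 0 < t) : sinSub t ≠ 0 :=
  div_ne_zero (mul_ne_zero two_ne_zero (ofReal_pos_ne_zero h0)) (one_add_sq_ne_zero t)

theorem EvenNumerator.divEven {k : ℕ} {h : ℕ → ℂ} (hh : EvenNumerator k h) :
    EvenValue (k + 1) (divEven h) := by
  obtain ⟨A, hA, C, hC, hAC, hs⟩ := hh.series
  have hsum : A + C ∈ polylogSpan k := Submodule.add_mem _ hA hC
  have h00 : (A + C) 0 = 0 := hAC
  have hf0 : _root_.divEven h 0 = 0 := by simp [_root_.divEven]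
  have hp := (hasPrimitive_intZero hsum).add (hasPrimitive_intImag hA)
  have hq := (hasPrimitive_intZero hsum).add (hasPrimitive_intReal hC)
  refine ⟨hh.logBounded.divEven, ⟨_, Submodule.add_mem _ (intZero_mem hsum) (intImag_mem hA),
    hp.zero.trans hf0.symm, eq_of_hasDerivAt_eq (F' := fun z => (1 - z ^ 2) / (z * (1 + z ^ 2)) *
        aperySeries h (sinSub z ^ 2))
      (fun t h0 h1 => hasDerivAt_aperySeries_divEven hh.logBounded hh.zero h0 h1)
      (fun t h0 h1 => ?_) (continuousAt_aperySeries_sinSub hh.logBounded.divEven.logBounded)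
      (continuousAt_powerSum (polyBounded_of_mem hp.mem) (by simp)) ?_⟩,
    _, hq.mem, hq.zero.trans hf0.symm,
    eq_of_hasDerivAt_eq (F' := fun z => aperySeries h (sinSub z ^ 2) / z)
      (F := fun z => cosSub z * aperySeries (weakSum (_root_.divEven h)) (sinSub z ^ 2))
      (fun t h0 h1 => hasDerivAt_cosSub_mul_weakSum_divEven hh.logBounded hh.zero h0 h1)
      (fun t h0 h1 => ?_) (continuousAt_cosSub.mul
        (continuousAt_aperySeries_sinSub hh.logBounded.divEven.logBounded_weakSum))
      (continuousAt_powerSum (polyBounded_of_mem hq.mem) (by simp)) ?_⟩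
  · convert! hp.deriv t h0 h1 using 1
    rw [hs t h0 h1, h00, powerSum_add (polyBounded_of_mem hA) (polyBounded_of_mem hC)
      (norm_ofReal_lt_one h0 h1)]
    have e1 := one_add_sq_ne_zero t
    have e2 := one_sub_sq_ne_zero h0 h1
    have e3 := ofReal_pos_ne_zero h0
    simp only [cosSub]
    field_simp
    ring
  · rw [aperySeries_sinSub_zero, powerSum_at_zero, hp.zero, hf0]
  · convert! hq.deriv t h0 h1 using 1
    rw [hs t h0 h1, h00, powerSum_add (polyBounded_of_mem hA) (polyBounded_of_mem hC)
      (norm_ofReal_lt_one h0 h1)]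
    have e1 := one_add_sq_ne_zero t
    have e2 := one_sub_sq_ne_zero h0 h1
    have e3 := ofReal_pos_ne_zero h0
    simp only [cosSub]
    field_simp
    ring
  · rw [powerSum_at_zero, hq.zero]
    simp [aperySeries_sinSub_zero, weakSum, hf0]

theorem OddNumerator.divOdd {k : ℕ} {h : ℕ → ℂ} (hh : OddNumerator k h) :
    OddValue (k + 1) (divOdd h) := by
  obtain ⟨B, hB, C, hC, hB0, hs⟩ := hh.series
  have hp := ((hasPrimitive_intZero hB).add (hasPrimitive_intImag hB)).add (hasPrimitive_intArc hC)
  have hq := ((hasPrimitive_intReal hC).sub (hasPrimitive_intImag hC)).sub (hasPrimitive_intArc hB)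
  -- `x Ψ_h` determines `Ψ_h` on `(0, 1)`
  have hs' : ∀ t : ℝ, 0 < t → t < 1 → aperySeries h (sinSub t ^ 2) =
      Complex.I * powerSum B t / sinSub t + powerSum C t / cosSub t := fun t h0 h1 => by
    have := sinSub_ne_zero h0
    rw [eq_comm, ← mul_right_inj' this, hs t h0 h1]
    field_simp
  refine ⟨hh.logBounded.divOdd, ⟨_, Submodule.add_mem _ (Submodule.add_mem _ (intZero_mem hB)
    (intImag_mem hB)) (intArc_mem hC), hp.zero, eq_of_hasDerivAt_eq
      (F := fun z => sinSub z * aperySeries (_root_.divOdd h) (sinSub z ^ 2))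
      (F' := fun z => 2 * (1 - z ^ 2) / (1 + z ^ 2) ^ 2 * aperySeries h (sinSub z ^ 2))
      (fun t h0 h1 => hasDerivAt_sinSub_mul_aperySeries_divOdd hh.logBounded h0 h1)
      (fun t h0 h1 => ?_) (continuousAt_sinSub.mul
        (continuousAt_aperySeries_sinSub hh.logBounded.divOdd.logBounded))
      (continuousAt_const.mul (continuousAt_powerSum (polyBounded_of_mem hp.mem) (by simp))) ?_⟩,
    _, hq.mem, hq.zero,
    eq_of_hasDerivAt_eq
      (F := fun z => cosSub z * aperySeries (strictSum (_root_.divOdd h)) (sinSub z ^ 2))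
      (F' := fun z => 4 * z / (1 + z ^ 2) ^ 2 * aperySeries h (sinSub z ^ 2))
      (fun t h0 h1 => hasDerivAt_cosSub_mul_strictSum_divOdd hh.logBounded h0 h1)
      (fun t h0 h1 => ?_) (continuousAt_cosSub.mul
        (continuousAt_aperySeries_sinSub hh.logBounded.divOdd.logBounded_strictSum))
      (continuousAt_powerSum (polyBounded_of_mem hq.mem) (by simp)) ?_⟩
  · convert! (hp.deriv t h0 h1).const_mul Complex.I using 1
    rw [hs' t h0 h1, hB0]
    have e1 := one_add_sq_ne_zero t
    have e2 := one_sub_sq_ne_zero h0 h1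
    have e3 := ofReal_pos_ne_zero h0
    simp only [cosSub, sinSub]
    field_simp
    ring_nf
    rw [Complex.I_sq]
    ring
  · rw [Pi.mul_apply, powerSum_at_zero, hp.zero]
    simp [sinSub]
  · convert! hq.deriv t h0 h1 using 1
    rw [hs' t h0 h1]
    have e1 := one_add_sq_ne_zero t
    have e2 := one_sub_sq_ne_zero h0 h1
    have e3 := ofReal_pos_ne_zero h0
    simp only [cosSub, sinSub]
    field_simp
    ring
  · rw [powerSum_at_zero, hq.zero]
    simp [aperySeries_sinSub_zero, strictSum]

theorem EvenValue.evenNumerator {k : ℕ} {f : ℕ → ℂ} (hf : EvenValue k f) (h0 : f 0 = 0) :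
    EvenNumerator k f := by
  obtain ⟨b, hb, hb0, hs⟩ := hf.series
  refine ⟨hf.logDecaying.logBounded, h0, b, admissibleSpan_le _ hb, 0, Submodule.zero_mem _,
    by simp [hb0, h0], fun t ht0 ht1 => ?_⟩
  rw [hs t ht0 ht1]
  simp [powerSum]

theorem EvenValue.evenNumerator_strictSum {k : ℕ} {f : ℕ → ℂ} (hf : EvenValue k f) :
    EvenNumerator k (strictSum f) := by
  obtain ⟨b, hb, hb0, hs⟩ := hf.series
  obtain ⟨C, hC, hC0, hw⟩ := hf.weak
  refine ⟨hf.logDecaying.logBounded_strictSum, by simp [strictSum], -b,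
    Submodule.neg_mem _ (admissibleSpan_le _ hb), C, hC, by simp [hb0, hC0], fun t h0 h1 => ?_⟩
  have hc := cosSub_ne_zero h0 h1
  rw [← hw t h0 h1, weakSum_eq, aperySeries_add hf.logDecaying.logBounded_strictSum
    hf.logDecaying.logBounded (norm_sinSub_sq_lt_one h0 h1), mul_div_cancel_left₀ _ hc, hs t h0 h1]
  simp [powerSum, tsum_neg]

theorem EvenValue.oddNumerator_weakSum {k : ℕ} {f : ℕ → ℂ} (hf : EvenValue k f) :
    OddNumerator k (weakSum f) := by
  obtain ⟨C, hC, -, hw⟩ := hf.weak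
  refine ⟨hf.logDecaying.logBounded_weakSum, 0, Submodule.zero_mem _, C, hC, rfl,
    fun t h0 h1 => ?_⟩
  rw [← hw t h0 h1, mul_div_cancel_left₀ _ (cosSub_ne_zero h0 h1)]
  simp [powerSum]

theorem OddValue.oddNumerator {k : ℕ} {f : ℕ → ℂ} (hf : OddValue k f) : OddNumerator k f := by
  obtain ⟨b, hb, hb0, hs⟩ := hf.series
  refine ⟨hf.logDecaying.logBounded, b, admissibleSpan_le _ hb, 0, Submodule.zero_mem _, hb0,
    fun t h0 h1 => ?_⟩
  rw [hs t h0 h1]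
  simp [powerSum]

theorem OddValue.oddNumerator_strictSum {k : ℕ} {f : ℕ → ℂ} (hf : OddValue k f) :
    OddNumerator k (strictSum f) := by
  obtain ⟨C, hC, -, hw⟩ := hf.strict
  refine ⟨hf.logDecaying.logBounded_strictSum, 0, Submodule.zero_mem _, C, hC, rfl,
    fun t h0 h1 => ?_⟩
  rw [← hw t h0 h1, mul_div_cancel_left₀ _ (cosSub_ne_zero h0 h1)]
  simp [powerSum]

theorem OddValue.evenNumerator_strictSum {k : ℕ} {f : ℕ → ℂ} (hf : OddValue k f) :
    EvenNumerator k (strictSum f) := by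
  obtain ⟨C, hC, hC0, hw⟩ := hf.strict
  refine ⟨hf.logDecaying.logBounded_strictSum, by simp [strictSum], 0, Submodule.zero_mem _, C, hC,
    by simp [hC0], fun t h0 h1 => ?_⟩
  rw [← hw t h0 h1, mul_div_cancel_left₀ _ (cosSub_ne_zero h0 h1)]
  simp [powerSum]

theorem evenValue_zero (k : ℕ) : EvenValue k 0 :=
  ⟨LogDecaying.zero, ⟨0, Submodule.zero_mem _, rfl, fun _ _ _ => by simp [aperySeries, powerSum]⟩,
    0, Submodule.zero_mem _, rfl, fun _ _ _ => by simp [aperySeries, powerSum, weakSum]⟩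

theorem oddValue_zero (k : ℕ) : OddValue k 0 :=
  ⟨LogDecaying.zero, ⟨0, Submodule.zero_mem _, rfl, fun _ _ _ => by simp [aperySeries, powerSum]⟩,
    0, Submodule.zero_mem _, rfl, fun _ _ _ => by simp [aperySeries, powerSum, strictSum]⟩

theorem strictSum_add (f g : ℕ → ℂ) : strictSum (f + g) = strictSum f + strictSum g := by
  ext n; simp [strictSum, Finset.sum_add_distrib]

theorem strictSum_smul (c : ℚ) (f : ℕ → ℂ) : strictSum (c • f) = c • strictSum f := by
  ext n; simp [strictSum, Finset.smul_sum]

theorem weakSum_add (f g : ℕ → ℂ) : weakSum (f + g) = weakSum f + weakSum g := by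
  rw [weakSum_eq, weakSum_eq, weakSum_eq, strictSum_add]; abel

theorem weakSum_smul (c : ℚ) (f : ℕ → ℂ) : weakSum (c • f) = c • weakSum f := by
  rw [weakSum_eq, weakSum_eq, strictSum_smul, smul_add]

theorem LogDecaying.smul {f : ℕ → ℂ} (hf : LogDecaying f) (c : ℚ) : LogDecaying (c • f) := by
  convert! hf.const_mul (c : ℂ) using 1

theorem EvenValue.add {k : ℕ} {f g : ℕ → ℂ} (hf : EvenValue k f) (hg : EvenValue k g) :
    EvenValue k (f + g) := by
  obtain ⟨b, hb, hb0, hs⟩ := hf.series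
  obtain ⟨C, hC, hC0, hw⟩ := hf.weak
  obtain ⟨b', hb', hb0', hs'⟩ := hg.series
  obtain ⟨C', hC', hC0', hw'⟩ := hg.weak
  refine ⟨hf.logDecaying.add hg.logDecaying,
    ⟨b + b', Submodule.add_mem _ hb hb', by simp [hb0, hb0'], fun t h0 h1 => ?_⟩,
    C + C', Submodule.add_mem _ hC hC', by simp [hC0, hC0'], fun t h0 h1 => ?_⟩
  · rw [aperySeries_add hf.logDecaying.logBounded hg.logDecaying.logBounded
      (norm_sinSub_sq_lt_one h0 h1), hs t h0 h1, hs' t h0 h1,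
      powerSum_add (polyBounded_of_mem (admissibleSpan_le _ hb))
        (polyBounded_of_mem (admissibleSpan_le _ hb')) (norm_ofReal_lt_one h0 h1)]
  · rw [weakSum_add, aperySeries_add hf.logDecaying.logBounded_weakSum
      hg.logDecaying.logBounded_weakSum (norm_sinSub_sq_lt_one h0 h1), mul_add, hw t h0 h1,
      hw' t h0 h1, powerSum_add (polyBounded_of_mem hC) (polyBounded_of_mem hC')
      (norm_ofReal_lt_one h0 h1)]

theorem EvenValue.smul {k : ℕ} {f : ℕ → ℂ} (hf : EvenValue k f) (c : ℚ) : EvenValue k (c • f) := by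
  obtain ⟨b, hb, hb0, hs⟩ := hf.series
  obtain ⟨C, hC, hC0, hw⟩ := hf.weak
  refine ⟨hf.logDecaying.smul c,
    ⟨c • b, Submodule.smul_mem _ c hb, by simp [hb0], fun t h0 h1 => ?_⟩,
    c • C, Submodule.smul_mem _ c hC, by simp [hC0], fun t h0 h1 => ?_⟩
  · rw [aperySeries_smul, powerSum_smul, hs t h0 h1]
  · rw [weakSum_smul, aperySeries_smul, powerSum_smul, ← hw t h0 h1]
    ring

theorem OddValue.add {k : ℕ} {f g : ℕ → ℂ} (hf : OddValue k f) (hg : OddValue k g) :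
    OddValue k (f + g) := by
  obtain ⟨b, hb, hb0, hs⟩ := hf.series
  obtain ⟨C, hC, hC0, hw⟩ := hf.strict
  obtain ⟨b', hb', hb0', hs'⟩ := hg.series
  obtain ⟨C', hC', hC0', hw'⟩ := hg.strict
  refine ⟨hf.logDecaying.add hg.logDecaying,
    ⟨b + b', Submodule.add_mem _ hb hb', by simp [hb0, hb0'], fun t h0 h1 => ?_⟩,
    C + C', Submodule.add_mem _ hC hC', by simp [hC0, hC0'], fun t h0 h1 => ?_⟩
  · rw [aperySeries_add hf.logDecaying.logBounded hg.logDecaying.logBounded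
      (norm_sinSub_sq_lt_one h0 h1), mul_add, hs t h0 h1, hs' t h0 h1,
      powerSum_add (polyBounded_of_mem (admissibleSpan_le _ hb))
        (polyBounded_of_mem (admissibleSpan_le _ hb')) (norm_ofReal_lt_one h0 h1), mul_add]
  · rw [strictSum_add, aperySeries_add hf.logDecaying.logBounded_strictSum
      hg.logDecaying.logBounded_strictSum (norm_sinSub_sq_lt_one h0 h1), mul_add, hw t h0 h1,
      hw' t h0 h1, powerSum_add (polyBounded_of_mem hC) (polyBounded_of_mem hC')
      (norm_ofReal_lt_one h0 h1)]

theorem OddValue.smul {k : ℕ} {f : ℕ → ℂ} (hf : OddValue k f) (c : ℚ) : OddValue k (c • f) := by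
  obtain ⟨b, hb, hb0, hs⟩ := hf.series
  obtain ⟨C, hC, hC0, hw⟩ := hf.strict
  refine ⟨hf.logDecaying.smul c,
    ⟨c • b, Submodule.smul_mem _ c hb, by simp [hb0], fun t h0 h1 => ?_⟩,
    c • C, Submodule.smul_mem _ c hC, by simp [hC0], fun t h0 h1 => ?_⟩
  · rw [aperySeries_smul, powerSum_smul, mul_left_comm, hs t h0 h1]
    ring
  · rw [strictSum_smul, aperySeries_smul, powerSum_smul, ← hw t h0 h1]
    ring

theorem evenValue_single : EvenValue 0 (Pi.single 0 1) := by
  have hL : LogDecaying (Pi.single 0 1 : ℕ → ℂ) := LogDecaying.single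
  refine ⟨hL, ⟨_, single_mem_admissibleSpan, rfl, fun t _ _ => ?_⟩, _,
    admissibleSpan_le _ single_mem_admissibleSpan, rfl, ?_⟩
  · have h : (fun n => (aperyCoeff n : ℂ) * (Pi.single 0 1 : ℕ → ℂ) n) = Pi.single 0 1 := by
      ext n
      rcases Nat.eq_zero_or_pos n with rfl | hn
      · simp [aperyCoeff_zero]
      · simp [hn.ne']
    rw [aperySeries, h, powerSum_single, powerSum_single]
  · refine eq_of_hasDerivAt_eq (F' := fun _ => 0)
      (F := fun z => cosSub z * aperySeries (weakSum (Pi.single 0 1)) (sinSub z ^ 2))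
      (fun t h0 h1 => ?_) (fun t _ _ => ?_) (continuousAt_cosSub.mul
        (continuousAt_aperySeries_sinSub hL.logBounded_weakSum))
      (continuousAt_powerSum hL.logBounded.polyBounded (by simp)) ?_
    -- the partial sums are constant, so that the derivative vanishes
    · have h := hasDerivAt_cosSub_mul_aperySeries (r := 0) hL.logBounded_weakSum
        LogDecaying.zero.logBounded.polyBounded (fun n => by simp [weakSum, Pi.single_apply]) h0 h1
      simpa [powerSum] using h
    · simpa only [show powerSum (Pi.single 0 1) = fun _ => 1 from funext powerSum_single] using
        hasDerivAt_const (t : ℂ) (1 : ℂ)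
    · simp [aperySeries_sinSub_zero, powerSum_single, cosSub_zero, weakSum]

theorem PureSeq.value {p : Bool} {k : ℕ} {f : ℕ → ℂ} (hf : PureSeq p k f) :
    if p then OddValue k f else EvenValue k f := by
  induction hf with
  | zero p k => cases p with
    | false => exact evenValue_zero k
    | true => exact oddValue_zero k
  | @add p _ _ _ _ _ hf hg => cases p with
    | false => exact EvenValue.add hf hg
    | true => exact OddValue.add hf hg
  | @smul p _ _ c _ hf => cases p with
    | false => exact EvenValue.smul hf c
    | true => exact OddValue.smul hf c
  | single => exact evenValue_single
  | even_even _ h0 hf => exact (EvenValue.evenNumerator hf h0).divEven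
  | @even_strict p _ _ _ hf => cases p with
    | false => exact (EvenValue.evenNumerator_strictSum hf).divEven
    | true => exact (OddValue.evenNumerator_strictSum hf).divEven
  | odd_odd _ hf => exact (OddValue.oddNumerator hf).divOdd
  | odd_weak _ hf => exact (EvenValue.oddNumerator_weakSum hf).divOdd
  | odd_strict _ hf => exact (OddValue.oddNumerator_strictSum hf).divOdd

theorem PureSeq.logDecaying {p : Bool} {k : ℕ} {f : ℕ → ℂ} (hf : PureSeq p k f) :
    LogDecaying f := by
  have := hf.value
  cases p with
  | false => exact EvenValue.logDecaying this
  | true => exact OddValue.logDecaying this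

theorem tendsto_sinSub_sq :
    Filter.Tendsto (fun t : ℝ => (2 * t / (1 + t ^ 2)) ^ 2) (nhdsWithin 1 (Set.Iio 1))
      (nhdsWithin 1 (Set.Iio 1)) := by
  refine tendsto_nhdsWithin_of_tendsto_nhds_of_eventually_within _ ?_ ?_
  · have h : Continuous fun t : ℝ => (2 * t / (1 + t ^ 2)) ^ 2 := by
      refine ((continuous_const.mul continuous_id).div (by fun_prop) fun t => ?_).pow 2
      positivity
    have := (h.tendsto 1).mono_left (nhdsWithin_le_nhds (s := Set.Iio (1 : ℝ)))
    norm_num at this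
    exact this
  · filter_upwards [Ioo_mem_nhdsLT (zero_lt_one' ℝ)] with t ht
    have h := norm_sinSub_sq_lt_one ht.1 ht.2
    have h' : sinSub t ^ 2 = ((2 * t / (1 + t ^ 2)) ^ 2 : ℝ) := by simp [sinSub]
    rw [h', Complex.norm_real, Real.norm_of_nonneg (by positivity)] at h
    exact h

/-- Abel's limit theorem at `x = 1`. -/
theorem LogDecaying.tendsto_aperySeries {f : ℕ → ℂ} (hf : LogDecaying f) :
    Filter.Tendsto (fun t : ℝ => aperySeries f (sinSub t ^ 2)) (nhdsWithin 1 (Set.Iio 1))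
      (nhds (∑' n, (aperyCoeff n : ℂ) * f n)) := by
  have h := Complex.tendsto_tsum_powerSeries_nhdsWithin_lt
    hf.summable_aperyCoeff_mul.hasSum.tendsto_sum_nat
  rw [Filter.tendsto_map'_iff] at h
  refine (h.comp tendsto_sinSub_sq).congr fun t => ?_
  simp [aperySeries, powerSum, sinSub]

theorem exists_tendsto_powerSum {w : ℕ} {b : ℕ → ℂ} (hb : b ∈ admissibleSpan w) :
    ∃ L ∈ CMZV w, Filter.Tendsto (fun t : ℝ => powerSum b t) (nhdsWithin 1 (Set.Iio 1))
      (nhds L) := by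
  obtain ⟨L, hL, h⟩ := exists_tendsto_sum_of_mem hb
  have h := Complex.tendsto_tsum_powerSeries_nhdsWithin_lt h
  rw [Filter.tendsto_map'_iff] at h
  exact ⟨L, hL, h⟩

theorem EvenValue.hasSum {k : ℕ} {f : ℕ → ℂ} (hf : EvenValue k f) :
    ∃ v ∈ CMZV k, HasSum (fun n => (aperyCoeff n : ℂ) * f n) v := by
  obtain ⟨b, hb, -, hs⟩ := hf.series
  obtain ⟨L, hL, hlim⟩ := exists_tendsto_powerSum hb
  have h : ∑' n, (aperyCoeff n : ℂ) * f n = L := by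
    refine tendsto_nhds_unique hf.logDecaying.tendsto_aperySeries (hlim.congr' ?_)
    filter_upwards [Ioo_mem_nhdsLT (zero_lt_one' ℝ)] with t ht using (hs t ht.1 ht.2).symm
  exact ⟨L, hL, h ▸ hf.logDecaying.summable_aperyCoeff_mul.hasSum⟩

theorem OddValue.hasSum {k : ℕ} {f : ℕ → ℂ} (hf : OddValue k f) :
    ∃ v ∈ CMZV k, HasSum (fun n => (aperyCoeff n : ℂ) * f n) (Complex.I * v) := by
  obtain ⟨b, hb, -, hs⟩ := hf.series
  obtain ⟨L, hL, hlim⟩ := exists_tendsto_powerSum hb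
  have hsin : Filter.Tendsto (fun t : ℝ => sinSub t) (nhdsWithin 1 (Set.Iio 1)) (nhds 1) := by
    have h1 := (hasDerivAt_sinSub 1).continuousAt.tendsto.comp
      ((Complex.continuous_ofReal.tendsto 1).mono_left (nhdsWithin_le_nhds (s := Set.Iio (1 : ℝ))))
    have h2 : sinSub (1 : ℝ) = 1 := by simp [sinSub]; norm_num
    rwa [h2] at h1
  have h : ∑' n, (aperyCoeff n : ℂ) * f n = Complex.I * L := by
    have h1 := hsin.mul hf.logDecaying.tendsto_aperySeries
    rw [one_mul] at h1
    refine tendsto_nhds_unique h1 ((hlim.const_mul Complex.I).congr' ?_)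
    filter_upwards [Ioo_mem_nhdsLT (zero_lt_one' ℝ)] with t ht using (hs t ht.1 ht.2).symm
  exact ⟨L, hL, h ▸ hf.logDecaying.summable_aperyCoeff_mul.hasSum⟩

/-! ### Partial fractions and mixed words -/

/-- Division by `2n - 1`. -/
noncomputable def divMinus (f : ℕ → ℂ) (n : ℕ) : ℂ := f n / (2 * n - 1)

/-- The shift `n ↦ f (n - 1)`, with value `0` at `n = 0`. -/
def shiftSeq (f : ℕ → ℂ) : ℕ → ℂ
  | 0 => 0
  | n + 1 => f n

theorem divEven_add (f g : ℕ → ℂ) : divEven (f + g) = divEven f + divEven g := by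
  ext n; simp [divEven, add_div]

theorem divOdd_add (f g : ℕ → ℂ) : divOdd (f + g) = divOdd f + divOdd g := by
  ext n; simp [divOdd, add_div]

theorem divMinus_add (f g : ℕ → ℂ) : divMinus (f + g) = divMinus f + divMinus g := by
  ext n; simp [divMinus, add_div]

theorem shiftSeq_add (f g : ℕ → ℂ) : shiftSeq (f + g) = shiftSeq f + shiftSeq g := by
  ext n; cases n <;> simp [shiftSeq]

theorem divEven_smul (c : ℚ) (f : ℕ → ℂ) : divEven (c • f) = c • divEven f := by
  ext n; simp [divEven, Rat.smul_def, mul_div_assoc]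

theorem divOdd_smul (c : ℚ) (f : ℕ → ℂ) : divOdd (c • f) = c • divOdd f := by
  ext n; simp [divOdd, Rat.smul_def, mul_div_assoc]

theorem divMinus_smul (c : ℚ) (f : ℕ → ℂ) : divMinus (c • f) = c • divMinus f := by
  ext n; simp [divMinus, Rat.smul_def, mul_div_assoc]

theorem shiftSeq_smul (c : ℚ) (f : ℕ → ℂ) : shiftSeq (c • f) = c • shiftSeq f := by
  ext n; cases n <;> simp [shiftSeq]

theorem divEven_sub (f g : ℕ → ℂ) : divEven (f - g) = divEven f - divEven g := by
  ext n; simp [divEven, sub_div]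

theorem divOdd_sub (f g : ℕ → ℂ) : divOdd (f - g) = divOdd f - divOdd g := by
  ext n; simp [divOdd, sub_div]

theorem two_mul_natCast_sub_one_ne_zero (n : ℕ) : (2 * (n : ℂ) - 1) ≠ 0 := by
  intro h
  have h1 : ((2 * n : ℕ) : ℂ) = ((1 : ℕ) : ℂ) := by push_cast; linear_combination h
  have h2 : 2 * n = 1 := by exact_mod_cast h1
  omega

theorem strictSum_eq_shiftSeq (f : ℕ → ℂ) : strictSum f = shiftSeq (weakSum f) := by
  ext n; cases n <;> simp [strictSum, shiftSeq, weakSum]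

theorem weakSum_shiftSeq (f : ℕ → ℂ) : weakSum (shiftSeq f) = strictSum f := by
  ext n; simp [weakSum, strictSum, Finset.sum_range_succ', shiftSeq]

theorem strictSum_shiftSeq (f : ℕ → ℂ) : strictSum (shiftSeq f) = strictSum f - shiftSeq f := by
  rw [← weakSum_shiftSeq f, weakSum_eq]; simp

theorem shiftSeq_strictSum (f : ℕ → ℂ) : shiftSeq (strictSum f) = strictSum f - shiftSeq f := by
  rw [← weakSum_shiftSeq f, ← strictSum_eq_shiftSeq, strictSum_shiftSeq, weakSum_shiftSeq]

theorem divMinus_shiftSeq (f : ℕ → ℂ) : divMinus (shiftSeq f) = shiftSeq (divOdd f) := by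
  ext n
  cases n with
  | zero => simp [divMinus, shiftSeq]
  | succ n =>
    simp only [divMinus, shiftSeq, divOdd]
    push_cast
    ring_nf

theorem divMinus_strictSum (f : ℕ → ℂ) :
    divMinus (strictSum f) = shiftSeq (divOdd (weakSum f)) := by
  rw [strictSum_eq_shiftSeq, divMinus_shiftSeq]

theorem divOdd_divEven {h : ℕ → ℂ} (h0 : h 0 = 0) :
    divOdd (divEven h) = divEven h - divOdd h := by
  ext n
  rcases Nat.eq_zero_or_pos n with rfl | hn
  · simp [divOdd, divEven, h0]
  · have h1 : (n : ℂ) ≠ 0 := by exact_mod_cast hn.ne'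
    have h2 := two_mul_natCast_add_one_ne_zero n
    simp only [divOdd, divEven, Pi.sub_apply]
    field_simp
    ring

theorem divMinus_divEven {h : ℕ → ℂ} (h0 : h 0 = 0) :
    divMinus (divEven h) = divMinus h - divEven h := by
  ext n
  rcases Nat.eq_zero_or_pos n with rfl | hn
  · simp [divMinus, divEven, h0]
  · have h1 : (n : ℂ) ≠ 0 := by exact_mod_cast hn.ne'
    have h2 := two_mul_natCast_sub_one_ne_zero n
    simp only [divMinus, divEven, Pi.sub_apply]
    field_simp
    ring

theorem divEven_divOdd (h : ℕ → ℂ) :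
    divEven (divOdd h) = divEven h - divOdd h + fun n => h 0 * (Pi.single 0 1 : ℕ → ℂ) n := by
  ext n
  rcases Nat.eq_zero_or_pos n with rfl | hn
  · simp [divOdd, divEven]
  · have h1 : (n : ℂ) ≠ 0 := by exact_mod_cast hn.ne'
    have h2 := two_mul_natCast_add_one_ne_zero n
    simp only [divOdd, divEven, Pi.sub_apply, Pi.add_apply, Pi.single_eq_of_ne hn.ne', mul_zero,
      add_zero]
    field_simp
    ring

theorem divMinus_divOdd (h : ℕ → ℂ) :
    divMinus (divOdd h) = (1 / 2 : ℚ) • (divMinus h - divOdd h) := by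
  ext n
  have h1 := two_mul_natCast_sub_one_ne_zero n
  have h2 := two_mul_natCast_add_one_ne_zero n
  simp only [divOdd, divMinus, Pi.smul_apply, Pi.sub_apply, Rat.smul_def]
  push_cast
  field_simp
  ring

theorem divEven_shiftSeq_divOdd (h : ℕ → ℂ) :
    divEven (shiftSeq (divOdd h)) = shiftSeq (divOdd h) - divEven (shiftSeq h) := by
  rw [← divMinus_shiftSeq]
  ext n
  rcases Nat.eq_zero_or_pos n with rfl | hn
  · simp [divMinus, divEven, shiftSeq]
  · have h1 : (n : ℂ) ≠ 0 := by exact_mod_cast hn.ne'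
    have h2 := two_mul_natCast_sub_one_ne_zero n
    simp only [divMinus, divEven, Pi.sub_apply]
    field_simp
    ring

theorem divOdd_shiftSeq_divOdd (h : ℕ → ℂ) :
    divOdd (shiftSeq (divOdd h)) =
      (1 / 2 : ℚ) • (shiftSeq (divOdd h) - divOdd (shiftSeq h)) := by
  rw [← divMinus_shiftSeq]
  ext n
  have h1 := two_mul_natCast_sub_one_ne_zero n
  have h2 := two_mul_natCast_add_one_ne_zero n
  simp only [divOdd, divMinus, Pi.smul_apply, Pi.sub_apply, Rat.smul_def]
  push_cast
  field_simp
  ring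

/-- Sequences from pure words of weight at most `m`, and shifts of sequences from pure odd words of
weight at most `k`. The shifted part absorbs the factors `2n - 1`. -/
noncomputable def mixedSpan (m k : ℕ) : Submodule ℚ (ℕ → ℂ) :=
  Submodule.span ℚ ({f | ∃ p, ∃ j ≤ m, PureSeq p j f} ∪
    {f | ∃ g, ∃ j ≤ k, PureSeq true j g ∧ f = shiftSeq g})

theorem mixedSpan_mono {m m' k k' : ℕ} (hm : m ≤ m') (hk : k ≤ k') :
    mixedSpan m k ≤ mixedSpan m' k' := by
  refine Submodule.span_mono (Set.union_subset_union ?_ ?_)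
  · rintro f ⟨p, j, hj, hf⟩
    exact ⟨p, j, hj.trans hm, hf⟩
  · rintro f ⟨g, j, hj, hg⟩
    exact ⟨g, j, hj.trans hk, hg⟩

theorem PureSeq.mem_mixedSpan {p : Bool} {j m k : ℕ} {f : ℕ → ℂ} (hf : PureSeq p j f)
    (h : j ≤ m) : f ∈ mixedSpan m k := Submodule.subset_span (Or.inl ⟨p, j, h, hf⟩)

theorem PureSeq.shiftSeq_mem_mixedSpan {j m k : ℕ} {f : ℕ → ℂ} (hf : PureSeq true j f)
    (h : j ≤ k) : shiftSeq f ∈ mixedSpan m k :=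
  Submodule.subset_span (Or.inr ⟨f, j, h, hf, rfl⟩)

theorem PureSeq.exists_rat {p : Bool} {k : ℕ} {f : ℕ → ℂ} (hf : PureSeq p k f) :
    ∃ r : ℚ, f 0 = r := by
  induction hf with
  | zero => exact ⟨0, by simp⟩
  | add _ _ hf hg =>
    obtain ⟨r, hr⟩ := hf
    obtain ⟨q, hq⟩ := hg
    exact ⟨r + q, by simp [hr, hq]⟩
  | smul c _ hf =>
    obtain ⟨r, hr⟩ := hf
    exact ⟨c * r, by simp [hr, Rat.smul_def]⟩
  | single => exact ⟨1, by simp⟩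
  | even_even | even_strict => exact ⟨0, by simp [divEven]⟩
  | odd_odd _ hf => simpa [divOdd] using hf
  | odd_weak _ hf => simpa [divOdd, weakSum] using hf
  | odd_strict => exact ⟨0, by simp [divOdd, strictSum]⟩

theorem PureSeq.divOdd_weakSum {p : Bool} {k : ℕ} {f : ℕ → ℂ} (hf : PureSeq p k f) :
    PureSeq true (k + 1) (divOdd (weakSum f)) := by
  cases p with
  | false => exact hf.odd_weak
  | true =>
    rw [weakSum_eq, divOdd_add]
    exact hf.odd_strict.add hf.odd_odd

theorem strictSum_eq_sub (f : ℕ → ℂ) : strictSum f = weakSum f - f := by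
  rw [weakSum_eq]; simp

/-- The statement proved by induction on pure words: a further division costs one unit of weight,
and a division by `2n - 1` creates new weight only in the shifted part. -/
structure DivisionsMixed (p : Bool) (k : ℕ) (f : ℕ → ℂ) : Prop where
  even : divEven f ∈ mixedSpan (k + 1) (k + 1)
  odd : divOdd f ∈ mixedSpan (k + 1) (k + 1)
  minus : divMinus f ∈ mixedSpan k (k + 1)
  even_shift : p = true → divEven (shiftSeq f) ∈ mixedSpan (k + 1) (k + 1)
  odd_shift : p = true → divOdd (shiftSeq f) ∈ mixedSpan (k + 1) (k + 1)

theorem divOdd_strictSum_mem {p : Bool} {k : ℕ} {f : ℕ → ℂ} (hf : PureSeq p k f)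
    (h : divOdd f ∈ mixedSpan (k + 1) (k + 1)) :
    divOdd (strictSum f) ∈ mixedSpan (k + 1) (k + 1) := by
  rw [strictSum_eq_sub, divOdd_sub]
  exact Submodule.sub_mem _ (hf.divOdd_weakSum.mem_mixedSpan le_rfl) h

theorem divMinus_strictSum_mem {p : Bool} {m k : ℕ} {f : ℕ → ℂ} (hf : PureSeq p k f) :
    divMinus (strictSum f) ∈ mixedSpan m (k + 1) := by
  rw [divMinus_strictSum]
  exact hf.divOdd_weakSum.shiftSeq_mem_mixedSpan le_rfl

/-- The part of the induction common to the words that end with a division by `2n + 1`. -/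
theorem DivisionsMixed.of_odd {k : ℕ} {h : ℕ → ℂ} (hp : PureSeq true (k + 1) (divOdd h))
    (heven : divEven h ∈ mixedSpan (k + 1) (k + 1))
    (hminus : divMinus h ∈ mixedSpan (k + 1) (k + 1))
    (hevenS : divEven (shiftSeq h) ∈ mixedSpan (k + 1) (k + 1))
    (hoddS : divOdd (shiftSeq h) ∈ mixedSpan (k + 1) (k + 1)) :
    DivisionsMixed true (k + 1) (divOdd h) := by
  have hm : mixedSpan (k + 1) (k + 1) ≤ mixedSpan (k + 2) (k + 2) :=
    mixedSpan_mono (Nat.le_succ _) (Nat.le_succ _)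
  have hm' : mixedSpan (k + 1) (k + 1) ≤ mixedSpan (k + 1) (k + 2) :=
    mixedSpan_mono le_rfl (Nat.le_succ _)
  have hS : shiftSeq (divOdd h) ∈ mixedSpan (k + 2) (k + 2) :=
    hp.shiftSeq_mem_mixedSpan (Nat.le_succ _)
  refine ⟨?_, hp.odd_odd.mem_mixedSpan le_rfl, ?_, fun _ => ?_, fun _ => ?_⟩
  · rw [divEven_divOdd]
    refine Submodule.add_mem _ (Submodule.sub_mem _ (hm heven)
      (hp.mem_mixedSpan (Nat.le_succ _))) ?_
    obtain ⟨r, hr⟩ := hp.exists_rat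
    have h0 : h 0 = r := by simpa [divOdd] using hr
    have h1 : (fun n => h 0 * (Pi.single 0 1 : ℕ → ℂ) n) = r • (Pi.single 0 1 : ℕ → ℂ) := by
      ext n; rw [h0, Pi.smul_apply, Rat.smul_def]
    rw [h1]
    exact Submodule.smul_mem _ r (PureSeq.single.mem_mixedSpan (Nat.zero_le _))
  · rw [divMinus_divOdd]
    exact Submodule.smul_mem _ _ (Submodule.sub_mem _ (hm' hminus) (hp.mem_mixedSpan le_rfl))
  · rw [divEven_shiftSeq_divOdd]
    exact Submodule.sub_mem _ hS (hm hevenS)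
  · rw [divOdd_shiftSeq_divOdd]
    exact Submodule.smul_mem _ _ (Submodule.sub_mem _ hS (hm hoddS))

/-- The part of the induction common to the words that end with a division by `2n`. -/
theorem DivisionsMixed.of_even {k : ℕ} {h : ℕ → ℂ} (hp : PureSeq false (k + 1) (divEven h))
    (h0 : h 0 = 0) (hodd : divOdd h ∈ mixedSpan (k + 1) (k + 1))
    (hminus : divMinus h ∈ mixedSpan (k + 1) (k + 1)) :
    DivisionsMixed false (k + 1) (divEven h) := by
  refine ⟨(hp.even_even (by simp [divEven])).mem_mixedSpan le_rfl, ?_, ?_,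
    fun h => by simp at h, fun h => by simp at h⟩
  · rw [divOdd_divEven h0]
    exact Submodule.sub_mem _ (hp.mem_mixedSpan (Nat.le_succ _))
      (mixedSpan_mono (Nat.le_succ _) (Nat.le_succ _) hodd)
  · rw [divMinus_divEven h0]
    exact Submodule.sub_mem _ (mixedSpan_mono le_rfl (Nat.le_succ _) hminus)
      (hp.mem_mixedSpan le_rfl)

theorem PureSeq.divisionsMixed {p : Bool} {k : ℕ} {f : ℕ → ℂ} (hf : PureSeq p k f) :
    DivisionsMixed p k f := by
  induction hf with
  | zero p k =>
    have h1 : divEven 0 = 0 := by ext; simp [divEven]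
    have h2 : divOdd 0 = 0 := by ext; simp [divOdd]
    have h3 : divMinus 0 = 0 := by ext; simp [divMinus]
    have h4 : shiftSeq 0 = 0 := by ext n; cases n <;> simp [shiftSeq]
    constructor <;> simp [h1, h2, h3, h4]
  | add _ _ hf hg =>
    exact ⟨divEven_add _ _ ▸ Submodule.add_mem _ hf.even hg.even,
      divOdd_add _ _ ▸ Submodule.add_mem _ hf.odd hg.odd,
      divMinus_add _ _ ▸ Submodule.add_mem _ hf.minus hg.minus,
      fun h => by
        rw [shiftSeq_add, divEven_add]
        exact Submodule.add_mem _ (hf.even_shift h) (hg.even_shift h),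
      fun h => by
        rw [shiftSeq_add, divOdd_add]
        exact Submodule.add_mem _ (hf.odd_shift h) (hg.odd_shift h)⟩
  | smul c _ hf =>
    exact ⟨divEven_smul c _ ▸ Submodule.smul_mem _ c hf.even,
      divOdd_smul c _ ▸ Submodule.smul_mem _ c hf.odd,
      divMinus_smul c _ ▸ Submodule.smul_mem _ c hf.minus,
      fun h => by
        rw [shiftSeq_smul, divEven_smul]
        exact Submodule.smul_mem _ c (hf.even_shift h),
      fun h => by
        rw [shiftSeq_smul, divOdd_smul]
        exact Submodule.smul_mem _ c (hf.odd_shift h)⟩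
  | single =>
    have h1 : divEven (Pi.single 0 1) = 0 := by
      ext n; rcases Nat.eq_zero_or_pos n with rfl | hn <;> simp [divEven]
      exact Or.inl (by simp [hn.ne'])
    have h2 : divOdd (Pi.single 0 1) = Pi.single 0 1 := by
      ext n; rcases Nat.eq_zero_or_pos n with rfl | hn
      · simp [divOdd]
      · simp [divOdd, hn.ne']
    have h3 : divMinus (Pi.single 0 1) = -Pi.single 0 1 := by
      ext n; rcases Nat.eq_zero_or_pos n with rfl | hn
      · simp [divMinus]
      · simp [divMinus, hn.ne']
    refine ⟨?_, ?_, ?_, fun h => by simp at h, fun h => by simp at h⟩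
    · rw [h1]; exact Submodule.zero_mem _
    · rw [h2]; exact PureSeq.single.mem_mixedSpan (Nat.zero_le _)
    · rw [h3]; exact Submodule.neg_mem _ (PureSeq.single.mem_mixedSpan (Nat.zero_le _))
  | even_even hg h0 ih =>
    exact DivisionsMixed.of_even (hg.even_even h0) h0 ih.odd
      (mixedSpan_mono (Nat.le_succ _) le_rfl ih.minus)
  | even_strict hg ih =>
    exact DivisionsMixed.of_even hg.even_strict (by simp [strictSum])
      (divOdd_strictSum_mem hg ih.odd) (divMinus_strictSum_mem hg)
  | odd_odd hg ih =>
    exact DivisionsMixed.of_odd hg.odd_odd ih.even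
      (mixedSpan_mono (Nat.le_succ _) le_rfl ih.minus) (ih.even_shift rfl) (ih.odd_shift rfl)
  | odd_weak hg ih =>
    refine DivisionsMixed.of_odd hg.odd_weak ?_ ?_ ?_ ?_
    · rw [weakSum_eq, divEven_add]
      exact Submodule.add_mem _ (hg.even_strict.mem_mixedSpan le_rfl) ih.even
    · rw [weakSum_eq, divMinus_add]
      exact Submodule.add_mem _ (divMinus_strictSum_mem hg)
        (mixedSpan_mono (Nat.le_succ _) le_rfl ih.minus)
    · rw [← strictSum_eq_shiftSeq]
      exact hg.even_strict.mem_mixedSpan le_rfl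
    · rw [← strictSum_eq_shiftSeq]
      exact divOdd_strictSum_mem hg ih.odd
  | odd_strict hg ih =>
    refine DivisionsMixed.of_odd hg.odd_strict (hg.even_strict.mem_mixedSpan le_rfl)
      (divMinus_strictSum_mem hg) ?_ ?_
    · rw [shiftSeq_strictSum, divEven_sub]
      exact Submodule.sub_mem _ (hg.even_strict.mem_mixedSpan le_rfl) (ih.even_shift rfl)
    · rw [shiftSeq_strictSum, divOdd_sub]
      exact Submodule.sub_mem _ (divOdd_strictSum_mem hg ih.odd) (ih.odd_shift rfl)

/-- Division by a linear form. -/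
noncomputable def divForm (l : LinForm) (f : ℕ → ℂ) (n : ℕ) : ℂ := f n / (l.val n : ℂ)

theorem divForm_even : divForm .even = divEven := by
  ext f n; simp [divForm, divEven, LinForm.val]

theorem divForm_oddPlus : divForm .oddPlus = divOdd := by
  ext f n; simp [divForm, divOdd, LinForm.val]

theorem divForm_oddMinus : divForm .oddMinus = divMinus := by
  ext f n; simp [divForm, divMinus, LinForm.val]

theorem divForm_add (l : LinForm) (f g : ℕ → ℂ) :
    divForm l (f + g) = divForm l f + divForm l g := by
  ext n; simp [divForm, add_div]

theorem divForm_smul (l : LinForm) (c : ℚ) (f : ℕ → ℂ) :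
    divForm l (c • f) = c • divForm l f := by
  ext n; simp [divForm, Rat.smul_def, mul_div_assoc]

/-- The span containing the quotient by the form `l` of a sequence of weight `k`: a division by
`2n - 1` does not raise the weight of the unshifted part. -/
noncomputable def targetSpan (l : LinForm) (k : ℕ) : Submodule ℚ (ℕ → ℂ) :=
  mixedSpan (if l = .oddMinus then k else k + 1) (k + 1)

theorem targetSpan_le (l : LinForm) (k : ℕ) : targetSpan l k ≤ mixedSpan (k + 1) (k + 1) :=
  mixedSpan_mono (by split <;> omega) le_rfl

theorem targetSpan_mono (l : LinForm) {j k : ℕ} (h : j ≤ k) : targetSpan l j ≤ targetSpan l k :=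
  mixedSpan_mono (by split <;> omega) (by omega)

theorem PureSeq.divForm_mem {p : Bool} {k : ℕ} {f : ℕ → ℂ} (hf : PureSeq p k f) (l : LinForm) :
    divForm l f ∈ targetSpan l k ∧ divForm l (strictSum f) ∈ targetSpan l k := by
  have h := hf.divisionsMixed
  cases l with
  | even => exact divForm_even ▸ ⟨h.even, hf.even_strict.mem_mixedSpan le_rfl⟩
  | oddPlus => exact divForm_oddPlus ▸ ⟨h.odd, divOdd_strictSum_mem hf h.odd⟩
  | oddMinus => exact divForm_oddMinus ▸ ⟨h.minus, divMinus_strictSum_mem hf⟩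

theorem PureSeq.divForm_shiftSeq_mem {k : ℕ} {f : ℕ → ℂ} (hf : PureSeq true k f) (l : LinForm) :
    divForm l (shiftSeq f) ∈ targetSpan l k ∧
      divForm l (strictSum (shiftSeq f)) ∈ targetSpan l k := by
  have h := hf.divisionsMixed
  rw [strictSum_shiftSeq]
  cases l with
  | even =>
    rw [divForm_even, divEven_sub]
    exact ⟨h.even_shift rfl, Submodule.sub_mem _ (hf.even_strict.mem_mixedSpan le_rfl)
      (h.even_shift rfl)⟩
  | oddPlus =>
    rw [divForm_oddPlus, divOdd_sub]
    exact ⟨h.odd_shift rfl, Submodule.sub_mem _ (divOdd_strictSum_mem hf h.odd)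
      (h.odd_shift rfl)⟩
  | oddMinus =>
    rw [divForm_oddMinus, ← shiftSeq_strictSum, divMinus_shiftSeq, divMinus_shiftSeq]
    exact ⟨hf.odd_odd.shiftSeq_mem_mixedSpan le_rfl, hf.odd_strict.shiftSeq_mem_mixedSpan le_rfl⟩

theorem divForm_mem_of_mem {k : ℕ} {f : ℕ → ℂ} (hf : f ∈ mixedSpan k k) (l : LinForm) :
    divForm l f ∈ targetSpan l k ∧ divForm l (strictSum f) ∈ targetSpan l k := by
  induction hf using Submodule.span_induction with
  | mem f hf =>
    rcases hf with ⟨p, j, hj, hf⟩ | ⟨g, j, hj, hg, rfl⟩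
    · exact (hf.divForm_mem l).imp (targetSpan_mono l hj ·) (targetSpan_mono l hj ·)
    · exact (hg.divForm_shiftSeq_mem l).imp (targetSpan_mono l hj ·) (targetSpan_mono l hj ·)
  | zero => exact ((PureSeq.zero false k).divForm_mem l)
  | add f g _ _ hf hg =>
    rw [strictSum_add, divForm_add, divForm_add]
    exact ⟨Submodule.add_mem _ hf.1 hg.1, Submodule.add_mem _ hf.2 hg.2⟩
  | smul c f _ hf =>
    rw [strictSum_smul, divForm_smul, divForm_smul]
    exact ⟨Submodule.smul_mem _ c hf.1, Submodule.smul_mem _ c hf.2⟩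

theorem divForm_iterate_apply (l : LinForm) (s : ℕ) (f : ℕ → ℂ) (n : ℕ) :
    (divForm l)^[s] f n = ((l.val n : ℂ) ^ s)⁻¹ * f n := by
  induction s with
  | zero => simp
  | succ s ih =>
    rw [Function.iterate_succ_apply', divForm, ih, pow_succ, mul_inv]
    ring

theorem divForm_iterate_mem {k : ℕ} {f : ℕ → ℂ} (l : LinForm) (s : ℕ)
    (hf : divForm l f ∈ targetSpan l k) : (divForm l)^[s + 1] f ∈ targetSpan l (k + s) := by
  induction s with
  | zero => exact hf
  | succ s ih =>
    rw [Function.iterate_succ_apply']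
    exact (divForm_mem_of_mem (targetSpan_le _ _ ih) l).1

/-- The nested sums belonging to a word of linear forms, with the junk value `0` for the inverse of
a vanishing factor. -/
noncomputable def wordSum (d : ℕ) (l : Fin d → LinForm) (s : Fin d → ℕ) (strict : Fin d → Bool) :
    ℕ → ℂ :=
  chainSum d (fun j n => (((l j).val n : ℂ) ^ s j)⁻¹) strict

theorem wordSum_succ (d : ℕ) (l : Fin (d + 1) → LinForm) (s : Fin (d + 1) → ℕ)
    (strict : Fin (d + 1) → Bool) :
    wordSum (d + 1) l s strict = (divForm (l 0))^[s 0]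
      (if strict 0 then strictSum (wordSum d (Fin.tail l) (Fin.tail s) (Fin.tail strict))
        else weakSum (wordSum d (Fin.tail l) (Fin.tail s) (Fin.tail strict))) := by
  ext n
  rw [divForm_iterate_apply]
  simp only [wordSum, chainSum]
  split <;> rfl

theorem wordSum_succ_mem (d : ℕ) (l : Fin (d + 1) → LinForm) (s : Fin (d + 1) → ℕ)
    (strict : Fin (d + 1) → Bool) (hs : 1 ≤ s 0)
    (h : wordSum d (Fin.tail l) (Fin.tail s) (Fin.tail strict) ∈
      mixedSpan (∑ j, Fin.tail s j) (∑ j, Fin.tail s j)) :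
    wordSum (d + 1) l s strict ∈ targetSpan (l 0) (∑ j, s j - 1) := by
  have h1 : ∑ j, s j - 1 = ∑ j, Fin.tail s j + (s 0 - 1) := by
    rw [Fin.sum_univ_succ]
    simp only [Fin.tail]
    omega
  have h2 : s 0 = s 0 - 1 + 1 := by omega
  rw [wordSum_succ, h1, h2]
  refine divForm_iterate_mem (l 0) (s 0 - 1) ?_
  have h3 := divForm_mem_of_mem h (l 0)
  split
  · exact h3.2
  · rw [weakSum_eq, divForm_add]
    exact Submodule.add_mem _ h3.2 h3.1

theorem wordSum_mem (d : ℕ) (l : Fin d → LinForm) (s : Fin d → ℕ) (strict : Fin d → Bool)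
    (hs : ∀ j, 1 ≤ s j) : wordSum d l s strict ∈ mixedSpan (∑ j, s j) (∑ j, s j) := by
  induction d with
  | zero => exact PureSeq.single.mem_mixedSpan (Nat.zero_le _)
  | succ d ih =>
    have h := targetSpan_le _ _ (wordSum_succ_mem d l s strict (hs 0)
      (ih (Fin.tail l) (Fin.tail s) (Fin.tail strict) fun j => hs j.succ))
    have h1 : ∑ j, s j - 1 + 1 = ∑ j, s j := by
      have := hs 0
      rw [Fin.sum_univ_succ]; omega
    rwa [h1] at h

/-! ### Summation against the central binomial coefficients -/

theorem CMZV_le_CMZVleGauss {j k : ℕ} (h : j ≤ k) {v : ℂ} (hv : v ∈ CMZV j) :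
    v ∈ CMZVleGauss k := by
  have hle : CMZV j ≤ CMZVle k := Submodule.span_mono fun x hx => ⟨j, h, hx⟩
  exact Submodule.subset_span (hle hv)

theorem CMZVleGauss_mono {j k : ℕ} (h : j ≤ k) : CMZVleGauss j ≤ CMZVleGauss k := by
  have hle : CMZVle j ≤ CMZVle k :=
    Submodule.span_mono fun x ⟨i, hi, hx⟩ => ⟨i, hi.trans h, hx⟩
  exact Submodule.span_mono hle

theorem I_mul_mem_CMZVleGauss {k : ℕ} {v : ℂ} (hv : v ∈ CMZVleGauss k) :
    Complex.I * v ∈ CMZVleGauss k :=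
  Submodule.smul_mem (CMZVleGauss k)
    (⟨Complex.I, Algebra.subset_adjoin rfl⟩ : Algebra.adjoin ℚ {Complex.I}) hv

theorem rat_smul_mem_CMZVleGauss {k : ℕ} {v : ℂ} (hv : v ∈ CMZVleGauss k) (c : ℚ) :
    c • v ∈ CMZVleGauss k := Submodule.smul_of_tower_mem _ c hv

theorem PureSeq.hasSum {p : Bool} {k m : ℕ} {f : ℕ → ℂ} (hf : PureSeq p k f) (hm : k ≤ m) :
    ∃ v ∈ CMZVleGauss m, HasSum (fun n => (aperyCoeff n : ℂ) * f n) v := by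
  have h := hf.value
  cases p with
  | false =>
    obtain ⟨v, hv, hs⟩ := EvenValue.hasSum h
    exact ⟨v, CMZV_le_CMZVleGauss hm hv, hs⟩
  | true =>
    obtain ⟨v, hv, hs⟩ := OddValue.hasSum h
    exact ⟨_, I_mul_mem_CMZVleGauss (CMZV_le_CMZVleGauss hm hv), hs⟩

theorem LogDecaying.summable_aperyCoeff_succ_mul {f : ℕ → ℂ} (hf : LogDecaying f) :
    Summable fun n => (aperyCoeff (n + 1) : ℂ) * f n := by
  refine Summable.of_norm_bounded hf.summable_aperyCoeff_mul.norm fun n => ?_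
  rw [norm_mul, norm_mul]
  refine mul_le_mul_of_nonneg_right ?_ (norm_nonneg _)
  rw [Complex.norm_real, Complex.norm_real, Real.norm_of_nonneg (aperyCoeff_nonneg _),
    Real.norm_of_nonneg (aperyCoeff_nonneg _)]
  have h := aperyCoeff_succ n
  have h1 := aperyCoeff_nonneg n
  have h2 := aperyCoeff_nonneg (n + 1)
  have h3 : (0 : ℝ) ≤ n := Nat.cast_nonneg n
  refine le_of_mul_le_mul_left ?_ (by positivity : (0 : ℝ) < 2 * n + 2)
  nlinarith

theorem LogBounded.tendsto_aperyCoeff_mul {f : ℕ → ℂ} (hf : LogBounded f) :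
    Filter.Tendsto (fun n => (aperyCoeff n : ℂ) * f n) Filter.atTop (nhds 0) := by
  obtain ⟨C, r, hC, hf⟩ := hf.exists_nonneg
  obtain ⟨D, hD, h⟩ := exists_harmonicGauge_pow_le r
  have h1 : Filter.Tendsto (fun n : ℕ => C * D * ((n : ℝ) + 1) ^ (-(1 / 4) : ℝ)) Filter.atTop
      (nhds (C * D * 0)) :=
    ((tendsto_rpow_neg_atTop (by norm_num)).comp
      (Filter.tendsto_atTop_add_const_right _ _ tendsto_natCast_atTop_atTop)).const_mul _
  rw [mul_zero] at h1
  refine squeeze_zero_norm (fun n => ?_) h1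
  have hn : (0 : ℝ) < (n : ℝ) + 1 := by positivity
  rw [norm_mul, Complex.norm_real, Real.norm_of_nonneg (aperyCoeff_nonneg n)]
  calc aperyCoeff n * ‖f n‖
      ≤ 1 / √((n : ℝ) + 1) * (C * (D * ((n : ℝ) + 1) ^ (1 / 4 : ℝ))) :=
        mul_le_mul (aperyCoeff_le n) ((hf n).trans (mul_le_mul_of_nonneg_left (h n) hC))
          (norm_nonneg _) (by positivity)
    _ = C * D * (((n : ℝ) + 1) ^ (-(1 / 2) : ℝ) * ((n : ℝ) + 1) ^ (1 / 4 : ℝ)) := by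
        rw [Real.sqrt_eq_rpow, Real.rpow_neg hn.le]; ring
    _ = C * D * ((n : ℝ) + 1) ^ (-(1 / 4) : ℝ) := by
        rw [← Real.rpow_add hn]; norm_num

/-- Summation by parts against `a_n - a_{n+1} = a_{n+1} / (2n + 1)`. -/
theorem hasSum_strictSum {q : ℕ → ℂ} (hq : LogDecaying q) {v : ℂ}
    (hv : HasSum (fun n => (aperyCoeff (n + 1) : ℂ) * q n) v) :
    HasSum (fun n => (aperyCoeff (n + 1) : ℂ) * divOdd (strictSum q) n) v := by
  have hs : Summable fun n => (aperyCoeff (n + 1) : ℂ) * divOdd (strictSum q) n :=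
    hq.logBounded_strictSum.divOdd.summable_aperyCoeff_succ_mul
  have hpart : ∀ N, ∑ n ∈ Finset.range N, (aperyCoeff (n + 1) : ℂ) * divOdd (strictSum q) n =
      ∑ n ∈ Finset.range N, (aperyCoeff (n + 1) : ℂ) * q n - aperyCoeff N * strictSum q N := by
    intro N
    induction N with
    | zero => simp [strictSum]
    | succ N ih =>
      have h1 := two_mul_natCast_add_one_ne_zero N
      have h2 := aperyCoeff_succ' N
      have h3 : (aperyCoeff (N + 1) : ℂ) * divOdd (strictSum q) N =
          (aperyCoeff N - aperyCoeff (N + 1)) * strictSum q N := by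
        rw [divOdd]
        field_simp
        linear_combination strictSum q N * h2
      have h4 : strictSum q (N + 1) = strictSum q N + q N := by
        simp [strictSum, Finset.sum_range_succ]
      rw [Finset.sum_range_succ, Finset.sum_range_succ, ih, h3, h4]
      ring
  have hlim := hv.tendsto_sum_nat.sub hq.logBounded_strictSum.tendsto_aperyCoeff_mul
  rw [sub_zero] at hlim
  have := tendsto_nhds_unique (hs.hasSum.tendsto_sum_nat) (hlim.congr fun N => (hpart N).symm)
  exact this ▸ hs.hasSum

theorem aperyCoeff_succ_mul_divOdd (q : ℕ → ℂ) (n : ℕ) :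
    (aperyCoeff (n + 1) : ℂ) * divOdd q n = aperyCoeff n * q n - aperyCoeff (n + 1) * q n := by
  have h1 := two_mul_natCast_add_one_ne_zero n
  have h2 := aperyCoeff_succ' n
  rw [divOdd]
  field_simp
  linear_combination q n * h2

/-- A leading factor `2n - 1` telescopes against `a_n`, which lowers the weight by one. -/
theorem PureSeq.hasSum_succ {p : Bool} {k : ℕ} {f : ℕ → ℂ} (hf : PureSeq p k f) :
    p = true → ∃ v ∈ CMZVleGauss (k - 1), HasSum (fun n => (aperyCoeff (n + 1) : ℂ) * f n) v := by
  induction hf with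
  | zero => exact fun _ => ⟨0, Submodule.zero_mem _, by simp⟩
  | add _ _ hf hg =>
    intro h
    obtain ⟨v, hv, hf⟩ := hf h
    obtain ⟨w, hw, hg⟩ := hg h
    exact ⟨v + w, Submodule.add_mem _ hv hw, by simpa [mul_add] using hf.add hg⟩
  | smul c _ hf =>
    intro h
    obtain ⟨v, hv, hf⟩ := hf h
    refine ⟨c • v, rat_smul_mem_CMZVleGauss hv c, ?_⟩
    simpa [Rat.smul_def, mul_left_comm] using hf.const_smul c
  | single | even_even | even_strict => exact fun h => by simp at h
  | odd_odd hg ih =>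
    intro _
    obtain ⟨v, hv, h1⟩ := ih rfl
    obtain ⟨w, hw, h2⟩ := hg.hasSum le_rfl
    refine ⟨w - v, Submodule.sub_mem _ hw (CMZVleGauss_mono (Nat.sub_le _ _) hv), ?_⟩
    simpa only [aperyCoeff_succ_mul_divOdd] using h2.sub h1
  | odd_weak hg =>
    intro _
    have h1 := hg.logDecaying.summable_aperyCoeff_succ_mul.hasSum
    obtain ⟨w, hw, h2⟩ := hg.hasSum le_rfl
    refine ⟨w, hw, ?_⟩
    have h3 := (hasSum_strictSum hg.logDecaying h1).add (h2.sub h1)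
    rw [weakSum_eq, divOdd_add]
    simpa only [Pi.add_apply, mul_add, aperyCoeff_succ_mul_divOdd, add_sub_cancel] using h3
  | odd_strict hg ih =>
    intro _
    obtain ⟨v, hv, h1⟩ := ih rfl
    exact ⟨v, CMZVleGauss_mono (Nat.sub_le _ _) hv, hasSum_strictSum hg.logDecaying h1⟩

theorem hasSum_of_mem_mixedSpan {m k : ℕ} (hk : k ≤ m + 1) {f : ℕ → ℂ} (hf : f ∈ mixedSpan m k) :
    ∃ v ∈ CMZVleGauss m, HasSum (fun n => (aperyCoeff n : ℂ) * f n) v := by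
  induction hf using Submodule.span_induction with
  | mem f hf =>
    rcases hf with ⟨p, j, hj, hf⟩ | ⟨g, j, hj, hg, rfl⟩
    · exact hf.hasSum hj
    · obtain ⟨v, hv, h⟩ := hg.hasSum_succ rfl
      refine ⟨v, CMZVleGauss_mono (by omega) hv, ?_⟩
      rw [← hasSum_nat_add_iff' 1]
      simpa [shiftSeq] using h
  | zero => exact ⟨0, Submodule.zero_mem _, by simp⟩
  | add f g _ _ hf hg =>
    obtain ⟨v, hv, hf⟩ := hf
    obtain ⟨w, hw, hg⟩ := hg
    exact ⟨v + w, Submodule.add_mem _ hv hw, by simpa [mul_add] using hf.add hg⟩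
  | smul c f _ hf =>
    obtain ⟨v, hv, hf⟩ := hf
    refine ⟨c • v, rat_smul_mem_CMZVleGauss hv c, ?_⟩
    simpa [Rat.smul_def, mul_left_comm] using hf.const_smul c

/-! ### Words without weight drop -/

/-- The sequence of a word with leading form `l` that needs no partial fractions. -/
def PureChain (l : LinForm) (k : ℕ) (f : ℕ → ℂ) : Prop :=
  match l with
  | .even => PureSeq false k f
  | .oddPlus => PureSeq true k f
  | .oddMinus => ∃ g, PureSeq true k g ∧ f = shiftSeq g

/-- The leading form of a word; the end of the chain counts as `2n`. -/
def headForm : (d : ℕ) → (Fin d → LinForm) → LinForm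
  | 0, _ => .even
  | _ + 1, l => l 0

theorem pureSeq_iterate_divEven {k : ℕ} {f : ℕ → ℂ} (hf : PureSeq false (k + 1) (divEven f))
    (s : ℕ) : PureSeq false (k + (s + 1)) (divEven^[s + 1] f) := by
  induction s with
  | zero => exact hf
  | succ s ih =>
    rw [Function.iterate_succ_apply']
    refine ih.even_even ?_
    rw [Function.iterate_succ_apply', divEven]
    simp

theorem pureSeq_iterate_divOdd {k : ℕ} {f : ℕ → ℂ} (hf : PureSeq true (k + 1) (divOdd f))
    (s : ℕ) : PureSeq true (k + (s + 1)) (divOdd^[s + 1] f) := by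
  induction s with
  | zero => exact hf
  | succ s ih =>
    rw [Function.iterate_succ_apply']
    exact ih.odd_odd

theorem divMinus_iterate_shiftSeq (s : ℕ) (f : ℕ → ℂ) :
    divMinus^[s] (shiftSeq f) = shiftSeq (divOdd^[s] f) := by
  induction s with
  | zero => rfl
  | succ s ih => rw [Function.iterate_succ_apply', Function.iterate_succ_apply', ih,
      divMinus_shiftSeq]

theorem PureChain.divOdd_weakSum {l : LinForm} {k : ℕ} {f : ℕ → ℂ} (hf : PureChain l k f) :
    PureSeq true (k + 1) (divOdd (weakSum f)) := by
  cases l with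
  | even => exact PureSeq.divOdd_weakSum hf
  | oddPlus => exact PureSeq.divOdd_weakSum hf
  | oddMinus =>
    obtain ⟨g, hg, rfl⟩ := hf
    rw [weakSum_shiftSeq]
    exact hg.odd_strict

theorem PureChain.cons {l l' : LinForm} {k : ℕ} {f : ℕ → ℂ} (hf : PureChain l' k f)
    (h : l' = .oddMinus → l ≠ .even) (s : ℕ) :
    PureChain l (k + (s + 1)) ((divForm l)^[s + 1]
      (if decide (l ≠ LinForm.oddPlus) then strictSum f else weakSum f)) := by
  cases l with
  | even =>
    have h1 : PureSeq false (k + 1) (divEven (strictSum f)) := by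
      cases l' with
      | even => exact PureSeq.even_strict hf
      | oddPlus => exact PureSeq.even_strict hf
      | oddMinus => exact absurd rfl (h rfl)
    rw [divForm_even]
    exact pureSeq_iterate_divEven h1 s
  | oddPlus =>
    rw [divForm_oddPlus]
    exact pureSeq_iterate_divOdd hf.divOdd_weakSum s
  | oddMinus =>
    refine ⟨divOdd^[s + 1] (weakSum f), pureSeq_iterate_divOdd hf.divOdd_weakSum s, ?_⟩
    rw [← divMinus_iterate_shiftSeq, ← strictSum_eq_shiftSeq, divForm_oddMinus]
    rfl

theorem pureChain_wordSum (d : ℕ) (l : Fin d → LinForm) (s : Fin d → ℕ) (hs : ∀ j, 1 ≤ s j)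
    (hl : ∀ (j : ℕ) (hj : j + 1 < d), l ⟨j + 1, hj⟩ = LinForm.oddMinus →
      l ⟨j, Nat.lt_of_succ_lt hj⟩ ≠ LinForm.even) :
    PureChain (headForm d l) (∑ j, s j) (wordSum d l s (basicStrict l)) := by
  induction d with
  | zero => exact PureSeq.single
  | succ d ih =>
    have h := ih (Fin.tail l) (Fin.tail s) (fun j => hs j.succ)
      fun j hj h => hl (j + 1) (Nat.succ_lt_succ hj) h
    have h1 : headForm d (Fin.tail l) = .oddMinus → l 0 ≠ .even := by
      cases d with
      | zero => exact fun h => by simp [headForm] at h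
      | succ d => exact fun h => hl 0 (by omega) h
    have h2 := h.cons h1 (s 0 - 1)
    have h3 : s 0 - 1 + 1 = s 0 := Nat.sub_add_cancel (hs 0)
    have h4 : ∑ j, Fin.tail s j + s 0 = ∑ j, s j := by
      rw [Fin.sum_univ_succ, add_comm]; rfl
    rw [h3, h4] at h2
    rw [wordSum_succ]
    exact h2

/-! ### The multiple series -/

open Classical in
/-- A multiple series over an index range may be summed over the first index last. -/
theorem hasSum_indexRange (d : ℕ) (a : ℕ → ℝ) (u : Fin d → ℕ → ℝ) (strict : Fin d → Bool)
    (h : Summable fun k => |a k| * chainSum d (fun j n => |u j n|) strict k) :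
    HasSum (fun n : indexRange strict => a (headIndex d n) * ∏ j, u j (n.1 j))
      (∑' k, a k * chainSum d u strict k) := by
  set F : ℕ × (Fin d → ℕ) → ℝ := fun x =>
    a x.1 * if x.2 ∈ indexRange strict ∧ headIndex d x.2 = x.1 then ∏ j, u j (x.2 j) else 0 with hF
  have hfib : ∀ k, HasSum (fun n => F (k, n)) (a k * chainSum d u strict k) := fun k =>
    (hasSum_chainSum d u strict k).mul_left (a k)
  have habs : ∀ x, |F x| = |a x.1| *
      if x.2 ∈ indexRange strict ∧ headIndex d x.2 = x.1 then ∏ j, |u j (x.2 j)| else 0 := by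
    intro x
    rw [hF, abs_mul, apply_ite abs, abs_zero, Finset.abs_prod]
  have hfib' : ∀ k, HasSum (fun n => |F (k, n)|)
      (|a k| * chainSum d (fun j n => |u j n|) strict k) := fun k => by
    have := (hasSum_chainSum d (fun j n => |u j n|) strict k).mul_left (|a k|)
    rw [show (fun n => |F (k, n)|) = _ from funext fun n => habs (k, n)]
    exact this
  have hsum : Summable F := by
    refine Summable.of_abs ((summable_prod_of_nonneg fun x => abs_nonneg _).2
      ⟨fun k => (hfib' k).summable, ?_⟩)
    simpa only [(hfib' _).tsum_eq] using h
  have h1 : HasSum F (∑' k, a k * chainSum d u strict k) := by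
    have := hsum.hasSum.prod_fiberwise hfib
    rw [this.tsum_eq]
    exact hsum.hasSum
  have h2 := ((Equiv.prodComm _ _).hasSum_iff.2 h1).prod_fiberwise
    (g := fun n => if n ∈ indexRange strict then a (headIndex d n) * ∏ j, u j (n j) else 0)
    fun n => by
      have h3 := hasSum_ite_eq (headIndex d n)
        (if n ∈ indexRange strict then a (headIndex d n) * ∏ j, u j (n j) else 0)
      convert! h3 using 1
      funext k
      simp only [hF, Function.comp_apply, Equiv.prodComm_apply, Prod.swap]
      by_cases hk : k = headIndex d n
      · subst hk
        by_cases hn : n ∈ indexRange strict <;> simp [hn]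
      · simp [hk, Ne.symm hk]
  have h4 := (hasSum_subtype_iff_indicator
    (f := fun n : Fin d → ℕ => a (headIndex d n) * ∏ j, u j (n j)) (s := indexRange strict)
    (a := ∑' k, a k * chainSum d u strict k)).2
  refine h4 ?_
  convert! h2 using 1

/-- If the form vanishes at `n`, the inverse has the junk value `0`, which is consistent with
leaving out the index. -/
theorem abs_inv_val_pow_le (l : LinForm) {s : ℕ} (hs : 1 ≤ s) (n : ℕ) :
    |(l.val n ^ s)⁻¹| ≤ 2 / ((n : ℝ) + 1) := by
  have hn : (0 : ℝ) ≤ n := Nat.cast_nonneg n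
  rcases eq_or_ne (l.val n) 0 with h0 | h0
  · rw [h0, zero_pow (by omega), inv_zero, abs_zero]
    positivity
  · have h : 1 ≤ |l.val n| ∧ (n : ℝ) + 1 ≤ 2 * |l.val n| := by
      rcases Nat.eq_zero_or_pos n with rfl | hpos
      · cases l <;> simp_all [LinForm.val]
      · have h1 : (1 : ℝ) ≤ n := by exact_mod_cast hpos
        cases l <;> simp only [LinForm.val] <;> rw [abs_of_nonneg (by linarith)] <;>
          constructor <;> linarith
    rw [abs_inv, abs_pow, inv_eq_one_div, div_le_div_iff₀ (by positivity) (by positivity)]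
    have := le_self_pow₀ h.1 (Nat.one_le_iff_ne_zero.1 hs)
    linarith

theorem summable_aperyCoeff_mul_chainSum (d : ℕ) (u : Fin d → ℕ → ℝ) (strict : Fin d → Bool)
    (hu : ∀ j n, |u j n| ≤ 2 / ((n : ℝ) + 1)) :
    Summable fun k => |aperyCoeff k| * chainSum d (fun j n => |u j n|) strict k := by
  obtain ⟨C, r, h⟩ := logDecaying_chainSum 2 d (fun j n => |u j n|) strict
    fun j n => by simpa using hu j n
  refine Summable.of_norm_bounded ((summable_harmonicGauge_div_mul_sqrt r).mul_left C) fun n => ?_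
  rw [norm_mul, Real.norm_eq_abs |aperyCoeff n|, abs_abs, abs_of_nonneg (aperyCoeff_nonneg n)]
  calc aperyCoeff n * _ ≤ 1 / √((n : ℝ) + 1) * (C * harmonicGauge n ^ r / ((n : ℝ) + 1)) :=
        mul_le_mul (aperyCoeff_le n) (h n) (norm_nonneg _) (by positivity)
    _ = _ := by ring

/-- The series converges absolutely for every choice of signs, and its sum is
`∑ a_n V(n)` with the nested sums `V`. -/
theorem aperySummable_and_aperySum_eq (d : ℕ) [NeZero d] (l : Fin d → LinForm) (s : Fin d → ℕ)
    (hs : ∀ j, 1 ≤ s j) (strict : Fin d → Bool) :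
    AperySummable l s strict ∧
      (aperySum l s strict : ℂ) = ∑' n, (aperyCoeff n : ℂ) * wordSum d l s strict n := by
  have h := hasSum_indexRange d aperyCoeff (fun j n => ((l j).val n ^ s j)⁻¹) strict
    (summable_aperyCoeff_mul_chainSum d _ strict fun j n => abs_inv_val_pow_le (l j) (hs j) n)
  have hterm : (fun n : indexRange strict => aperyTerm l s n) = fun n : indexRange strict =>
      aperyCoeff (headIndex d n) * ∏ j, ((l j).val (n.1 j) ^ s j)⁻¹ := by
    funext n
    have h0 : headIndex d n = n.1 0 := by
      obtain ⟨d, rfl⟩ := Nat.exists_eq_succ_of_ne_zero (NeZero.ne d)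
      rfl
    rw [aperyTerm, h0, Finset.prod_inv_distrib, div_eq_mul_inv]
  rw [← hterm] at h
  refine ⟨h.summable, ?_⟩
  rw [aperySum, h.tsum_eq, Complex.ofReal_tsum]
  refine tsum_congr fun n => ?_
  rw [Complex.ofReal_mul, wordSum]
  congr 1
  have := map_chainSum Complex.ofRealHom d (fun j n => ((l j).val n ^ s j)⁻¹) strict n
  simpa using this

theorem aperySum_mem_CMZVleGauss (d : ℕ) [NeZero d] (l : Fin d → LinForm) (s : Fin d → ℕ)
    (hs : ∀ j, 1 ≤ s j) (strict : Fin d → Bool) :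
    (aperySum l s strict : ℂ) ∈ CMZVleGauss ((∑ j, s j) - weightDrop (l 0) (s 0)) := by
  rw [(aperySummable_and_aperySum_eq d l s hs strict).2]
  obtain ⟨d, rfl⟩ := Nat.exists_eq_succ_of_ne_zero (NeZero.ne d)
  have h := wordSum_succ_mem d l s strict (hs 0)
    (wordSum_mem d (Fin.tail l) (Fin.tail s) (Fin.tail strict) fun j => hs j.succ)
  have h1 : 1 ≤ ∑ j, s j := by
    have := hs 0
    rw [Fin.sum_univ_succ]; omega
  obtain ⟨v, hv, hsum⟩ := hasSum_of_mem_mixedSpan (by split <;> omega) h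
  rw [hsum.tsum_eq]
  refine CMZVleGauss_mono ?_ hv
  unfold weightDrop
  split_ifs <;> simp_all

theorem aperySum_basicStrict (d : ℕ) [NeZero d] (l : Fin d → LinForm) (s : Fin d → ℕ)
    (hs : ∀ j, 1 ≤ s j) (h0 : l 0 ≠ LinForm.oddMinus)
    (hl : ∀ (j : ℕ) (hj : j + 1 < d), l ⟨j + 1, hj⟩ = LinForm.oddMinus →
      l ⟨j, Nat.lt_of_succ_lt hj⟩ ≠ LinForm.even) :
    ∃ x ∈ CMZV (∑ j, s j),
      (aperySum l s (basicStrict l) : ℂ) = Complex.I ^ (l 0).delta * x := by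
  rw [(aperySummable_and_aperySum_eq d l s hs _).2]
  have h := pureChain_wordSum d l s hs hl
  have h1 : headForm d l = l 0 := by
    obtain ⟨d, rfl⟩ := Nat.exists_eq_succ_of_ne_zero (NeZero.ne d)
    rfl
  rw [h1] at h
  cases h2 : l 0 with
  | even =>
    rw [h2] at h
    obtain ⟨v, hv, hsum⟩ := EvenValue.hasSum (PureSeq.value h)
    exact ⟨v, hv, by rw [hsum.tsum_eq]; simp [LinForm.delta]⟩
  | oddPlus =>
    rw [h2] at h
    obtain ⟨v, hv, hsum⟩ := OddValue.hasSum (PureSeq.value h)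
    exact ⟨v, hv, by rw [hsum.tsum_eq]; simp [LinForm.delta]⟩
  | oddMinus => exact absurd h2 h0

theorem mainTheorem1 (d : ℕ) [NeZero d] (l : Fin d → LinForm) (s : Fin d → ℕ)
    (hs : ∀ j, 1 ≤ s j) :
    -- (a)
    (l 0 ≠ LinForm.oddMinus →
      (∀ (j : ℕ) (hj : j + 1 < d), l ⟨j + 1, hj⟩ = LinForm.oddMinus →
        l ⟨j, Nat.lt_of_succ_lt hj⟩ ≠ LinForm.even) →
      AperySummable l s (basicStrict l) ∧
      ∃ x ∈ CMZV (∑ j, s j),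
        (aperySum l s (basicStrict l) : ℂ) = Complex.I ^ (l 0).delta * x) ∧
    -- (b)
    (AperySummable l s (basicStrict l) ∧
      (aperySum l s (basicStrict l) : ℂ) ∈ CMZVleGauss ((∑ j, s j) - weightDrop (l 0) (s 0))) ∧
    -- (c)
    (∀ strict : Fin d → Bool, SeriesDefined l strict →
      AperySummable l s strict ∧
      (aperySum l s strict : ℂ) ∈ CMZVleGauss ((∑ j, s j) - weightDrop (l 0) (s 0))) := by
  have hsum := fun strict => (aperySummable_and_aperySum_eq d l s hs strict).1
  exact ⟨fun h0 hl => ⟨hsum _, aperySum_basicStrict d l s hs h0 hl⟩,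
    ⟨hsum _, aperySum_mem_CMZVleGauss d l s hs _⟩,
    fun strict _ => ⟨hsum _, aperySum_mem_CMZVleGauss d l s hs strict⟩⟩
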